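/- Let $\mathbb T=\{0,-1,-2,\dots\}$, let $E$ be a finite set and let $F$ be a Polish space with its Borel $\sigma$-algebra. For a sequence $K=(K_n)_{n\in\mathbb T}$ of Markov kernels on $E$, let $\Pi_K$ be the set of all sequences $(\pi_n)_{n\in\mathbb T}$ of probability distributions on $E$ such that $\sum_{z}\pi_{n-1}(z)K_n(z,x)=\pi_n(x)$ for all $n\in\mathbb T$, $x\in E$ (absolute probabilities for $K$). **The model.** Let $M=(M_n)_{n\in\mathbb T}$ be Markov kernels on $E$, let $\pi\in\Pi_M$, let $\psi$ be a $\sigma$-finite measure on $F$, and let $g_n:E\times F\to[0,\infty)$ be measurable with $\int_F g_n(x,y)\,\psi(dy)=1$ for all $n\in\mathbb T$, $x\in E$. Let $\mathbf P$ be the law of the corresponding hidden Markov model on $\Omega=E^{\mathbb T}\times F^{\mathbb T}$ (with the product $\sigma$-algebra $\mathcal F$ and coordinate processes $X,Y$), i.e. the probability measure such that for all $n\in\mathbb T$, $x_n,\dots,x_0\in E$ and Borel $B_n,\dots,B_0\subset F$, $$\mathbf P(X_k=x_k,\,Y_k\in B_k,\ n\le k\le 0)=\pi_n(x_n)\prod_{k=n+1}^{0}M_k(x_{k-1},x_k)\prod_{k=n}^{0}\int_{B_k}g_k(x_k,y)\,\psi(dy).$$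 **Conditional kernels.** For $y\in F^{\mathbb T}$ put $\phi_1\equiv 1$ and, for $n\in\mathbb T$, $\phi_n(x)=\sum_{x'}M_n(x,x')g_n(x',y_n)\phi_{n+1}(x')$ (depending on $y_n,\dots,y_0$). Let $M_n^y(x,x')=M_n(x,x')g_n(x',y_n)\phi_{n+1}(x')/\phi_n(x)$ if $\phi_n(x)>0$, and $M_n^y(x,x')=M_n(x,x')$ if $\phi_n(x)=0$; write $M^y=(M^y_n)_{n\in\mathbb T}$. **Coupling.** Let $\mathbf Q^y$ be the probability measure under which the $E$-valued variables $(\xi_n^x)_{n\in\mathbb T,x\in E}$ are independent with $\mathbf Q^y(\xi_n^x=x')=M_n^y(x,x')$. Put $\Phi_n(x)=\xi_n^x$ and $\Phi_{n,k}=\Phi_k\circ\Phi_{k-1}\circ\dots\circ\Phi_{n+1}$ for $n<k$, and let $T_k=\sup\{n<k:\ \text{the image of }\Phi_{n,k}\text{ is a singleton}\}$, with $T_k=-\infty$ if there is no such $n$. **Conditional and chain laws.** Let $\mathcal T=\bigcap_{n\in\mathbb T}\sigma(\tilde X_k;k\le n)$ be the tail $\sigma$-algebra on $E^{\mathbb T}$,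 where $\tilde X_k$ are the coordinates. Let $y\mapsto P^{y}$ be any probability kernel from $F^{\mathbb T}$ to $E^{\mathbb T}$ that is a regular conditional law of $X$ given $Y$: for each measurable $A\subset E^{\mathbb T}$, $P^{Y(\omega)}(A)=\mathbf P(X\in A\mid\sigma(Y))(\omega)$ for $\mathbf P$-almost all $\omega$. For $y\in F^{\mathbb T}$ and $\pi^y\in\Pi_{M^y}$, let $P_{\pi^y}$ be the unique probability measure on $E^{\mathbb T}$ with $$P_{\pi^y}(\tilde X_n=x_n,\dots,\tilde X_0=x_0)=\pi^y_n(x_n)\prod_{k=n+1}^{0}M^y_k(x_{k-1},x_k)$$ for all $n\in\mathbb T$ and $x_n,\dots,x_0\in E$. **Theorem.** The following are equivalent. 1. $\mathbf Q^{Y(\omega)}\bigl(\bigcap_{n\in\mathbb T}\{T_n>-\infty\}\bigr)=1$ for $\mathbf P$-almost all $\omega\in\Omega$. 2. There is a set $H\in\mathcal F$ with $\mathbf P(H)=1$ such that $$P^{Y(\omega)}(A)=P^{Y(\omega)}(A)^2=P_{\pi^{Y(\omega)}}(A)$$ for all $\omega\in H$, all $A\in\mathcal T$ and all $\pi^{Y(\omega)}\in\Pi_{M^{Y(\omega)}}$.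 -/

import Mathlib

open MeasureTheory ProbabilityTheory
open scoped ENNReal NNReal

/-! Time runs over the nonpositive integers. The natural number `k` stands for the time `-k`, so the
successor of `k` is one step further into the past, and a path is a function on `ℕ`. -/

namespace HMM

noncomputable section

section Chains

variable {E : Type*}

/-- The sequences of absolute probabilities of a sequence of Markov kernels. Here `M k x x'` is the
probability of moving from `x` at time `-(k+1)` to `x'` at time `-k`, and `p k` is a distribution
at time `-k`; the condition says `∑ z, p (k+1) z * M k z x = p k x`. -/
def absProbs (M : ℕ → E → PMF E) : Set (ℕ → PMF E) :=
  {p | ∀ k, (p (k + 1)).bind (M k) = p k}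

/-- `μ` is the path law of the chain with transitions `M` and marginals `p`:
`μ(X_{-n} = x_{-n}, …, X_0 = x_0) = p_{-n}(x_{-n}) ∏ M_j(x_{j-1}, x_j)`, the product being over the
times `j = -n+1, …, 0`. -/
structure IsChainLaw [MeasurableSpace E] (M : ℕ → E → PMF E) (p : ℕ → PMF E)
    (μ : Measure (ℕ → E)) : Prop where
  isProb : IsProbabilityMeasure μ
  fidi : ∀ (n : ℕ) (x : ℕ → E), μ {X | ∀ k ≤ n, X k = x k} =
    p n (x n) * ∏ k ∈ Finset.range n, M k (x (k + 1)) (x k)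

/-- The tail σ-algebra of the signal: the intersection over `n` of the σ-algebras generated by the
coordinates at times `≤ -n`. -/
@[reducible]
def tail (E : Type*) [MeasurableSpace E] : MeasurableSpace (ℕ → E) :=
  ⨅ n : ℕ, ⨆ k : ℕ, ⨆ _ : n ≤ k, MeasurableSpace.comap (fun X : ℕ → E => X k) inferInstance

end Chains

section ChainLaw

variable {E : Type*}

/-- Time-reversed transition probabilities of a chain with transitions `M` and marginals `p`. -/
def revKernel (M : ℕ → E → PMF E) (p : ℕ → PMF E) (hp : p ∈ absProbs M) (k : ℕ) (x : E) : PMF E :=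
  open Classical in
  if h : p k x = 0 then p k else
    PMF.normalize (fun x' => p (k + 1) x' * M k x' x)
      (by rw [← PMF.bind_apply, hp k]; exact h)
      (by rw [← PMF.bind_apply, hp k]; exact PMF.apply_ne_top _ _)

lemma revKernel_mul (M : ℕ → E → PMF E) (p : ℕ → PMF E) (hp : p ∈ absProbs M) (k : ℕ) (x x' : E) :
    p k x * revKernel M p hp k x x' = p (k + 1) x' * M k x' x := by
  have hs : ∑' z, p (k + 1) z * M k z x = p k x := by rw [← PMF.bind_apply, hp k]
  by_cases h : p k x = 0
  · rw [h, ENNReal.tsum_eq_zero] at hs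
    rw [h, zero_mul, hs x']
  · rw [revKernel, dif_neg h, PMF.normalize_apply, hs, mul_comm (p (k + 1) x' * M k x' x),
      ← mul_assoc, ENNReal.mul_inv_cancel h (PMF.apply_ne_top _ _), one_mul]

/-- Recursive path `X_0 = a`, `X_{-(k+1)} = ζ (k, X_{-k})`. -/
def revPath (w : E × (ℕ × E → E)) : ℕ → E
  | 0 => w.1
  | k + 1 => w.2 (k, revPath w k)

variable [Fintype E] [MeasurableSpace E] [MeasurableSingletonClass E]

lemma measurable_revPath : Measurable (revPath : E × (ℕ × E → E) → ℕ → E) := by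
  refine measurable_pi_lambda _ fun k => ?_
  induction k with
  | zero => exact measurable_fst
  | succ k ih =>
    have h : Measurable fun q : (ℕ × E → E) × E => q.1 (k, q.2) :=
      measurable_from_prod_countable_left fun e => measurable_pi_apply (k, e)
    exact h.comp (measurable_snd.prodMk ih)

/-- Every sequence of absolute probabilities is the sequence of marginals of a chain. -/
theorem exists_isChainLaw (M : ℕ → E → PMF E) (p : ℕ → PMF E) (hp : p ∈ absProbs M) :
    ∃ μ : Measure (ℕ → E), IsChainLaw M p μ := by
  let ρ : Measure (ℕ × E → E) :=
    Measure.infinitePi fun q : ℕ × E => (revKernel M p hp q.1 q.2).toMeasure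
  let μ : Measure (E × (ℕ × E → E)) := (p 0).toMeasure.prod ρ
  refine ⟨μ.map revPath, Measure.isProbabilityMeasure_map measurable_revPath.aemeasurable, ?_⟩
  intro n x
  have hms : MeasurableSet {X : ℕ → E | ∀ k ≤ n, X k = x k} := by
    rw [show {X : ℕ → E | ∀ k ≤ n, X k = x k} = ⋂ k, ⋂ (_ : k ≤ n), (fun X => X k) ⁻¹' {x k} by
      ext X; simp]
    exact MeasurableSet.iInter fun k => MeasurableSet.iInter fun _ =>
      measurable_pi_apply k (measurableSet_singleton (x k))
  rw [Measure.map_apply measurable_revPath hms]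
  have hinj : Function.Injective fun k : ℕ => (k, x k) := fun a b h => (Prod.ext_iff.1 h).1
  let emb : ℕ ↪ ℕ × E := ⟨_, hinj⟩
  have hemb : ∀ k, emb k = (k, x k) := fun _ => rfl
  let s : Finset (ℕ × E) := (Finset.range n).map emb
  have hset : revPath ⁻¹' {X : ℕ → E | ∀ k ≤ n, X k = x k} =
      {x 0} ×ˢ Set.pi (s : Set (ℕ × E)) (fun q => {x (q.1 + 1)}) := by
    ext ⟨a, ζ⟩
    simp only [Set.mem_preimage, Set.mem_ofPred_eq, Set.mem_prod, Set.mem_singleton_iff, Set.mem_pi,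
      s, Finset.coe_map, hemb, Set.mem_image, Finset.coe_range, Set.mem_Iio,
      forall_exists_index, and_imp]
    constructor
    · intro h
      refine ⟨h 0 (Nat.zero_le _), ?_⟩
      rintro q k hk rfl
      have h1 := h (k + 1) hk
      rw [revPath, h k hk.le] at h1
      exact h1
    · rintro ⟨h0, h1⟩ k
      induction k with
      | zero => exact fun _ => h0
      | succ k ih =>
        intro hk
        rw [revPath, ih (by omega)]
        exact h1 _ k hk rfl
  rw [hset, Measure.prod_prod, Measure.infinitePi_pi _ (fun _ _ => measurableSet_singleton _),
    Finset.prod_map, PMF.toMeasure_apply_singleton _ _ (measurableSet_singleton _)]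
  simp only [hemb,
    PMF.toMeasure_apply_singleton _ _ (measurableSet_singleton _)]
  clear hset hms s
  induction n with
  | zero => simp
  | succ n ih =>
    rw [Finset.prod_range_succ, ← mul_assoc, ih, Finset.prod_range_succ, mul_right_comm,
      revKernel_mul, mul_assoc, mul_comm (M n _ _)]

/-- The path law of a chain is unique. -/
theorem IsChainLaw.unique {M : ℕ → E → PMF E} {p : ℕ → PMF E} {μ ν : Measure (ℕ → E)}
    (hμ : IsChainLaw M p μ) (hν : IsChainLaw M p ν) : μ = ν := by
  have := hμ.isProb
  have := hν.isProb
  have hproj : ∀ I : Finset ℕ, IsProbabilityMeasure (ν.map I.restrict) := fun I =>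
    Measure.isProbabilityMeasure_map (Finset.measurable_restrict I).aemeasurable
  have hfam : IsProjectiveMeasureFamily fun I : Finset ℕ => ν.map I.restrict := by
    intro I J hJI
    rw [Measure.map_map (Finset.measurable_restrict₂ hJI) (Finset.measurable_restrict I)]
    rfl
  have hνlim : IsProjectiveLimit ν fun I : Finset ℕ => ν.map I.restrict := fun I => rfl
  refine IsProjectiveLimit.unique (P := fun I : Finset ℕ => ν.map I.restrict) ?_ hνlim
  rw [isProjectiveLimit_nat_iff hfam]
  intro n
  refine Measure.ext_of_singleton fun z => ?_
  obtain ⟨e, -⟩ := (p 0).support_nonempty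
  let x : ℕ → E := fun k => if h : k ∈ Finset.Iic n then z ⟨k, h⟩ else e
  have hpre : (Preorder.frestrictLe (π := fun _ : ℕ => E) n) ⁻¹' {z} = {X | ∀ k ≤ n, X k = x k} := by
    ext X
    simp only [Set.mem_preimage, Set.mem_singleton_iff, Set.mem_ofPred_eq, funext_iff,
      Subtype.forall]
    refine forall_congr' fun k => ?_
    constructor
    · intro h hk
      have := h (Finset.mem_Iic.2 hk)
      simpa [x, hk] using this
    · intro h hk
      have := h (Finset.mem_Iic.1 hk)
      simpa [x, Finset.mem_Iic.1 hk] using this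
  have hz : MeasurableSet ({z} : Set (∀ _ : Finset.Iic n, E)) := measurableSet_singleton z
  rw [Measure.map_apply (Preorder.measurable_frestrictLe n) hz, hpre, hμ.fidi]
  change _ = (ν.map (Preorder.frestrictLe n)) {z}
  rw [Measure.map_apply (Preorder.measurable_frestrictLe n) hz, hpre, hν.fidi]

/-- The path law of the chain with transitions `M` and absolute probabilities `p`, the unique
measure with the prescribed finite dimensional distributions. -/
def chainLaw (M : ℕ → E → PMF E) (p : ℕ → PMF E) (hp : p ∈ absProbs M) : Measure (ℕ → E) :=
  (exists_isChainLaw M p hp).choose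

theorem isChainLaw_chainLaw (M : ℕ → E → PMF E) (p : ℕ → PMF E) (hp : p ∈ absProbs M) :
    IsChainLaw M p (chainLaw M p hp) :=
  (exists_isChainLaw M p hp).choose_spec

end ChainLaw

section Coupling

variable {E : Type*}

/-- The law under which the `ξ (k, x)` (time `-k`, state `x`) are independent and `ξ (k, x)` has
distribution `K k x`. -/
def couplingLaw [MeasurableSpace E] (K : ℕ → E → PMF E) : Measure (ℕ × E → E) :=
  Measure.infinitePi fun q : ℕ × E => (K q.1 q.2).toMeasure

/-- The composed random map `Φ_{n,m} = Φ_m ∘ Φ_{m-1} ∘ ⋯ ∘ Φ_{n+1}` for the times `m = -k` and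
`n = -(k+j)`, where `Φ_i(x) = ξ_i^x`. -/
def compMap (ξ : ℕ × E → E) (k : ℕ) : ℕ → E → E
  | 0 => id
  | j + 1 => fun x => compMap ξ k j (ξ (k + j, x))

/-- Minus the coalescence time: `-T_m` for `m = -k`, where `T_m` is the supremum of the times
`n < m` such that the image of `Φ_{n,m}` is a singleton. The value is `⊤` (that is, `T_m = -∞`) if
there is no such time. -/
def coalescenceTime (ξ : ℕ × E → E) (k : ℕ) : ℕ∞ :=
  sInf {t | ∃ j : ℕ, 0 < j ∧ (∃ z, Set.range (compMap ξ k j) = {z}) ∧ t = ((k + j : ℕ) : ℕ∞)}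

end Coupling

section Model

variable {E F : Type*}

/-- `P` is the law of the hidden Markov model on the product of the signal path space and the
observation path space: the signal is the chain with transitions `M` and absolute probabilities `p`,
and given the signal the observations are independent, the one at time `-k` having density
`g k (X_{-k})` with respect to `ψ`. -/
structure IsHMMLaw [MeasurableSpace E] [MeasurableSpace F] (M : ℕ → E → PMF E) (p : ℕ → PMF E)
    (ψ : Measure F) (g : ℕ → E → F → ℝ≥0) (P : Measure ((ℕ → E) × (ℕ → F))) : Prop where
  isProb : IsProbabilityMeasure P
  fidi : ∀ (n : ℕ) (x : ℕ → E) (B : ℕ → Set F), (∀ k, MeasurableSet (B k)) →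
    P {ω | ∀ k ≤ n, ω.1 k = x k ∧ ω.2 k ∈ B k} =
      (p n (x n) * ∏ k ∈ Finset.range n, M k (x (k + 1)) (x k)) *
        ∏ k ∈ Finset.range (n + 1), ∫⁻ y in B k, (g k (x k) y : ℝ≥0∞) ∂ψ

/-- `κ` is a regular conditional law of the signal path given the σ-algebra generated by the
observations: for every event `A`, `κ (Y ω) A` is a version of `P(X ∈ A | Y)(ω)`. -/
structure IsRegCondLaw [MeasurableSpace E] [MeasurableSpace F] (P : Measure ((ℕ → E) × (ℕ → F)))
    (κ : Kernel (ℕ → F) (ℕ → E)) : Prop where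
  isMarkov : IsMarkovKernel κ
  ae_eq : ∀ A : Set (ℕ → E), MeasurableSet A →
    (fun ω : (ℕ → E) × (ℕ → F) => (κ ω.2).real A) =ᵐ[P]
      P⟦Prod.fst ⁻¹' A | MeasurableSpace.comap Prod.snd inferInstance⟧

/-- Regular conditional laws of the signal exist. -/
theorem isRegCondLaw_condDistrib [MeasurableSpace E] [MeasurableSpace F] [Fintype E] [Nonempty E]
    [MeasurableSingletonClass E] (P : Measure ((ℕ → E) × (ℕ → F))) [IsProbabilityMeasure P] :
    IsRegCondLaw P (condDistrib Prod.fst Prod.snd P) where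
  isMarkov := inferInstance
  ae_eq _ hA := condDistrib_ae_eq_condExp measurable_snd measurable_fst hA

variable [Fintype E]

/-- `phi M g y (k+1)` is the function `φ_{-k}(·, y_{-k:0})`, and `phi M g y 0` is `φ_1 = 1`. -/
def phi (M : ℕ → E → PMF E) (g : ℕ → E → F → ℝ≥0) (y : ℕ → F) : ℕ → E → ℝ≥0∞
  | 0 => fun _ => 1
  | k + 1 => fun x => ∑ x', M k x x' * g k x' (y k) * phi M g y k x'

lemma phi_ne_top (M : ℕ → E → PMF E) (g : ℕ → E → F → ℝ≥0) (y : ℕ → F) (k : ℕ) (x : E) :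
    phi M g y k x ≠ ∞ := by
  induction k generalizing x with
  | zero => simp [phi]
  | succ k ih =>
    rw [phi]
    exact ENNReal.sum_ne_top.2 fun x' _ =>
      ENNReal.mul_ne_top (ENNReal.mul_ne_top (PMF.apply_ne_top _ _) ENNReal.coe_ne_top) (ih x')

/-- The transition kernels `M_{-k}^y` of the conditional signal process. -/
def condKernel (M : ℕ → E → PMF E) (g : ℕ → E → F → ℝ≥0) (y : ℕ → F) (k : ℕ) (x : E) : PMF E :=
  open Classical in
  if h : 0 < phi M g y (k + 1) x then
    PMF.ofFintype
      (fun x' => M k x x' * g k x' (y k) * phi M g y k x' / phi M g y (k + 1) x)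
      (by
        simp only [div_eq_mul_inv]
        rw [← Finset.sum_mul]
        exact ENNReal.mul_inv_cancel h.ne' (phi_ne_top M g y (k + 1) x))
  else M k x

end Model

end

end HMM

namespace HMM

/-! ### Path operations and cylinder sets. -/

section PathShift

/-- The path with value `z` at time `0` and the path `X` before. -/
def pathCons {E : Type*} (z : E) (X : ℕ → E) : ℕ → E
  | 0 => z
  | k + 1 => X k

/-- The path one step further into the past. -/
def pathShift {E : Type*} (X : ℕ → E) : ℕ → E := fun k => X (k + 1)

variable {E F : Type*}

@[simp] lemma pathCons_zero (z : E) (X : ℕ → E) : pathCons z X 0 = z := rfl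

@[simp] lemma pathCons_succ (z : E) (X : ℕ → E) (k : ℕ) : pathCons z X (k + 1) = X k := rfl

@[simp] lemma pathShift_apply (X : ℕ → E) (k : ℕ) : pathShift X k = X (k + 1) := rfl

lemma measurable_pathShift [MeasurableSpace E] : Measurable (pathShift : (ℕ → E) → ℕ → E) :=
  measurable_pi_lambda _ fun k => measurable_pi_apply (k + 1)

lemma measurable_pathCons [MeasurableSpace E] :
    Measurable fun q : E × (ℕ → E) => pathCons q.1 q.2 := by
  refine measurable_pi_lambda _ fun k => ?_
  cases k with
  | zero => exact measurable_fst
  | succ k => exact (measurable_pi_apply k).comp measurable_snd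

lemma measurable_pathCons_right [MeasurableSpace E] (z : E) :
    Measurable (pathCons z : (ℕ → E) → ℕ → E) :=
  measurable_pathCons.comp measurable_prodMk_left

lemma sum_pmf_eq_one [Fintype E] (q : PMF E) : ∑ x, q x = 1 := by
  rw [← tsum_fintype (L := SummationFilter.unconditional E)]
  exact q.tsum_coe

lemma measurable_pathShift_prod [MeasurableSpace E] [MeasurableSpace F] :
    Measurable fun ω : (ℕ → E) × (ℕ → F) => (pathShift ω.1, pathShift ω.2) :=
  (measurable_pathShift.comp measurable_fst).prodMk (measurable_pathShift.comp measurable_snd)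

lemma measurable_pathCons_prod [MeasurableSpace E] [MeasurableSpace F] (z : E) :
    Measurable fun q : ((ℕ → E) × (ℕ → F)) × F => (pathCons z q.1.1, pathCons q.2 q.1.2) :=
  ((measurable_pathCons_right z).comp (measurable_fst.comp measurable_fst)).prodMk
    (measurable_pathCons.comp (measurable_snd.prodMk (measurable_snd.comp measurable_fst)))

lemma measurableSet_apply_eq [MeasurableSpace E] [MeasurableSingletonClass E] (n : ℕ) (x : E) :
    MeasurableSet {X : ℕ → E | X n = x} :=
  (measurable_pi_apply (X := fun _ : ℕ => E) n) (measurableSet_singleton x)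

lemma sum_measure_apply_eq [Fintype E] [MeasurableSpace E] [MeasurableSingletonClass E]
    {μ : Measure (ℕ → E)} [IsProbabilityMeasure μ] (n : ℕ) : ∑ x, μ {X | X n = x} = 1 := by
  rw [← measure_univ (μ := μ), ← tsum_fintype (L := SummationFilter.unconditional E),
    ← measure_iUnion _ fun x => measurableSet_apply_eq n x]
  · congr 1
    ext X; simp
  · intro a b hab
    exact Set.disjoint_left.2 fun X (h : X n = a) (h' : X n = b) => hab (h.symm.trans h')

lemma measurableSet_cylinder [MeasurableSpace E] [MeasurableSingletonClass E] (n : ℕ) (x : ℕ → E) :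
    MeasurableSet {X : ℕ → E | ∀ k ≤ n, X k = x k} := by
  measurability

lemma measurableSet_cylinder_prod [MeasurableSpace E] [MeasurableSingletonClass E]
    [MeasurableSpace F] (n : ℕ) (x : ℕ → E) (B : ℕ → Set F) (hB : ∀ k, MeasurableSet (B k)) :
    MeasurableSet {ω : (ℕ → E) × (ℕ → F) | ∀ k ≤ n, ω.1 k = x k ∧ ω.2 k ∈ B k} := by
  simp only [Set.ofPred_forall]
  refine MeasurableSet.iInter fun k => MeasurableSet.iInter fun _ => MeasurableSet.inter ?_ ?_
  · exact ((measurable_pi_apply (X := fun _ : ℕ => E) k).comp measurable_fst)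
      (measurableSet_singleton (x k))
  · exact ((measurable_pi_apply (X := fun _ : ℕ => F) k).comp measurable_snd) (hB k)

/-- Finite measures on signal and observation paths are determined by the cylinders of length at
least two. -/
lemma ext_of_cylinders [Fintype E] [MeasurableSpace E] [MeasurableSingletonClass E]
    [MeasurableSpace F] {P Q : Measure ((ℕ → E) × (ℕ → F))} [IsFiniteMeasure P]
    (huniv : P Set.univ = Q Set.univ)
    (h : ∀ (n : ℕ) (x : ℕ → E) (B : ℕ → Set F), (∀ k, MeasurableSet (B k)) →
      P {ω | ∀ k ≤ n + 1, ω.1 k = x k ∧ ω.2 k ∈ B k} =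
        Q {ω | ∀ k ≤ n + 1, ω.1 k = x k ∧ ω.2 k ∈ B k}) : P = Q := by
  let C : Set (Set ((ℕ → E) × (ℕ → F))) :=
    {s | s = ∅ ∨ ∃ (n : ℕ) (x : ℕ → E) (B : ℕ → Set F), (∀ k, MeasurableSet (B k)) ∧
      s = {ω | ∀ k ≤ n + 1, ω.1 k = x k ∧ ω.2 k ∈ B k}}
  have key : ∀ (n m : ℕ) (x x' : ℕ → E) (B B' : ℕ → Set F), n ≤ m → (∀ k, MeasurableSet (B k)) →
      (∀ k, MeasurableSet (B' k)) →
      {ω : (ℕ → E) × (ℕ → F) | ∀ k ≤ n + 1, ω.1 k = x k ∧ ω.2 k ∈ B k} ∩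
        {ω | ∀ k ≤ m + 1, ω.1 k = x' k ∧ ω.2 k ∈ B' k} ∈ C := by
    intro n m x x' B B' hnm hB hB'
    by_cases hx : ∀ k ≤ n + 1, x k = x' k
    -- Compatible prefixes: the longer cylinder absorbs the shorter one, which constrains the
    -- observations only up to index `n + 1`.
    · refine Or.inr ⟨m, x', fun k => (if k ≤ n + 1 then B k else Set.univ) ∩ B' k, fun k => ?_, ?_⟩
      · dsimp only
        split_ifs
        · exact (hB k).inter (hB' k)
        · exact MeasurableSet.univ.inter (hB' k)
      · ext ω
        simp only [Set.mem_inter_iff, Set.mem_ofPred_eq]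
        constructor
        · rintro ⟨h1, h2⟩ k hk
          refine ⟨(h2 k hk).1, ?_, (h2 k hk).2⟩
          split_ifs with hkn
          · exact (h1 k hkn).2
          · trivial
        · intro h1
          refine ⟨fun k hk => ?_, fun k hk => ⟨(h1 k hk).1, (h1 k hk).2.2⟩⟩
          have h2 := h1 k (by omega)
          rw [if_pos hk] at h2
          exact ⟨h2.1.trans (hx k hk).symm, h2.2.1⟩
    · push Not at hx
      obtain ⟨k, hk, hne⟩ := hx
      refine Or.inl (Set.eq_empty_of_forall_notMem ?_)
      rintro ω ⟨h1, h2⟩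
      exact hne ((h1 k hk).1.symm.trans (h2 k (by omega)).1)
  have hpi : IsPiSystem C := by
    rintro s hs t ht -
    rcases hs with rfl | ⟨n, x, B, hB, rfl⟩
    · exact Or.inl (Set.empty_inter _)
    rcases ht with rfl | ⟨m, x', B', hB', rfl⟩
    · exact Or.inl (Set.inter_empty _)
    rcases le_total n m with hnm | hnm
    · exact key n m x x' B B' hnm hB hB'
    · rw [Set.inter_comm]
      exact key m n x' x B' B hnm hB' hB
  have hgen : (inferInstance : MeasurableSpace ((ℕ → E) × (ℕ → F))) =
      MeasurableSpace.generateFrom C := by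
    refine le_antisymm ?_ (MeasurableSpace.generateFrom_le ?_)
    · have hbase : ∀ (k : ℕ) (A : Set E) (B : Set F), MeasurableSet B →
          MeasurableSet[MeasurableSpace.generateFrom C]
            {ω : (ℕ → E) × (ℕ → F) | ω.1 k ∈ A ∧ ω.2 k ∈ B} := by
        intro k A B hB
        classical
        rcases isEmpty_or_nonempty E with hE | ⟨⟨e⟩⟩
        · rw [Set.eq_empty_of_forall_notMem
            (s := {ω : (ℕ → E) × (ℕ → F) | ω.1 k ∈ A ∧ ω.2 k ∈ B}) fun ω _ => hE.elim (ω.1 0)]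
          exact MeasurableSpace.measurableSet_empty _
        let ex : (Fin (k + 2) → E) → ℕ → E := fun u i => if h : i < k + 2 then u ⟨i, h⟩ else e
        let BB : ℕ → Set F := fun i => if i = k then B else Set.univ
        -- As `E` is finite, a one-coordinate event is a finite union of cylinders, over all initial
        -- signal segments `u` with an admissible `k`-th entry.
        have : {ω : (ℕ → E) × (ℕ → F) | ω.1 k ∈ A ∧ ω.2 k ∈ B} =
            ⋃ u : Fin (k + 2) → E, ⋃ (_ : ex u k ∈ A),
              {ω | ∀ i ≤ k + 1, ω.1 i = ex u i ∧ ω.2 i ∈ BB i} := by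
          ext ω
          simp only [Set.mem_ofPred_eq, Set.mem_iUnion, exists_prop]
          constructor
          · rintro ⟨h1, h2⟩
            have hex : ∀ i ≤ k + 1, ω.1 i = ex (fun j => ω.1 (j : ℕ)) i := fun i hi => by
              simp [ex, show i < k + 2 by omega]
            refine ⟨fun j => ω.1 j, by rwa [← hex k (by omega)], fun i hi => ⟨hex i hi, ?_⟩⟩
            by_cases hik : i = k
            · subst hik; simpa [BB] using h2
            · simp [BB, hik]
          · rintro ⟨u, hu, h1⟩
            have h2 := h1 k (by omega)
            exact ⟨h2.1 ▸ hu, by simpa [BB] using h2.2⟩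
        rw [this]
        refine MeasurableSet.iUnion fun u => MeasurableSet.iUnion fun _ => ?_
        refine MeasurableSpace.measurableSet_generateFrom (Or.inr ⟨k, ex u, BB, fun i => ?_, rfl⟩)
        by_cases hik : i = k
        · simpa [BB, hik] using hB
        · simp [BB, hik]
      refine sup_le ?_ ?_
      · rw [MeasurableSpace.pi, MeasurableSpace.comap_iSup]
        refine iSup_le fun k => ?_
        rw [MeasurableSpace.comap_comp]
        rintro _ ⟨A, -, rfl⟩
        simpa [Set.preimage] using hbase k A Set.univ MeasurableSet.univ
      · rw [MeasurableSpace.pi, MeasurableSpace.comap_iSup]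
        refine iSup_le fun k => ?_
        rw [MeasurableSpace.comap_comp]
        rintro _ ⟨B, hB, rfl⟩
        simpa [Set.preimage] using hbase k Set.univ B hB
    · rintro s (rfl | ⟨n, x, B, hB, rfl⟩)
      · exact MeasurableSet.empty
      · exact measurableSet_cylinder_prod _ x B hB
  refine ext_of_generate_finite C hgen hpi ?_ huniv
  rintro s (rfl | ⟨n, x, B, hB, rfl⟩)
  · simp
  · exact h n x B hB

end PathShift

/-! ### The one-step decomposition of a hidden Markov model. -/

section OneStep

variable {E F : Type*} [Fintype E] [MeasurableSpace E] [MeasurableSingletonClass E]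
  [MeasurableSpace F] {M : ℕ → E → PMF E} {p : ℕ → PMF E} {ψ : Measure F}
  {g : ℕ → E → F → ℝ≥0} {P : Measure ((ℕ → E) × (ℕ → F))}

/-- The past of a hidden Markov model is a hidden Markov model. -/
theorem IsHMMLaw.map_pathShift (hg_one : ∀ k x, ∫⁻ y, (g k x y : ℝ≥0∞) ∂ψ = 1)
    (hP : IsHMMLaw M p ψ g P) :
    IsHMMLaw (fun k => M (k + 1)) (fun k => p (k + 1)) ψ (fun k => g (k + 1))
      (P.map fun ω => (pathShift ω.1, pathShift ω.2)) := by
  have := hP.isProb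
  refine ⟨Measure.isProbabilityMeasure_map measurable_pathShift_prod.aemeasurable, ?_⟩
  intro n x B hB
  rw [Measure.map_apply measurable_pathShift_prod (measurableSet_cylinder_prod n x B hB)]
  have hset : (fun ω : (ℕ → E) × (ℕ → F) => (pathShift ω.1, pathShift ω.2)) ⁻¹'
      {ω | ∀ k ≤ n, ω.1 k = x k ∧ ω.2 k ∈ B k} =
      ⋃ z : E, {ω | ∀ k ≤ n + 1, ω.1 k = pathCons z x k ∧ ω.2 k ∈ pathCons Set.univ B k} := by
    ext ω
    simp only [Set.mem_preimage, Set.mem_ofPred_eq, Set.mem_iUnion, pathShift_apply]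
    constructor
    · intro h
      refine ⟨ω.1 0, fun k hk => ?_⟩
      cases k with
      | zero => simp
      | succ k => exact h k (by omega)
    · rintro ⟨z, h⟩ k hk
      exact h (k + 1) (by omega)
  have hBc : ∀ k, MeasurableSet (pathCons Set.univ B k) := by
    intro k
    cases k with
    | zero => exact MeasurableSet.univ
    | succ k => exact hB k
  rw [hset, measure_iUnion, tsum_fintype]
  · simp only [hP.fidi (n + 1) _ _ hBc, Finset.prod_range_succ' _ (n + 1), pathCons_succ,
      pathCons_zero, Finset.prod_range_succ' _ n, Measure.restrict_univ, hg_one, mul_one, zero_add]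
    rw [← Finset.sum_mul, ← Finset.mul_sum, ← Finset.mul_sum, sum_pmf_eq_one, mul_one]
  · intro z z' hzz'
    refine Set.disjoint_left.2 fun ω h h' => hzz' ?_
    exact (h 0 (by omega)).1.symm.trans (h' 0 (by omega)).1
  · exact fun z => measurableSet_cylinder_prod _ _ _ hBc

/-- Integration of the last signal and observation variables of a hidden Markov model. -/
theorem IsHMMLaw.lintegral_eq [SigmaFinite ψ] (hg : ∀ k x, Measurable (g k x))
    (hg_one : ∀ k x, ∫⁻ y, (g k x y : ℝ≥0∞) ∂ψ = 1) (hP : IsHMMLaw M p ψ g P)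
    {f : (ℕ → E) × (ℕ → F) → ℝ≥0∞} (hf : Measurable f) :
    ∫⁻ ω, f ω ∂P = ∑ z, ∫⁻ y, g 0 z y * ∫⁻ ω, M 0 (ω.1 0) z *
      f (pathCons z ω.1, pathCons y ω.2) ∂(P.map fun ω => (pathShift ω.1, pathShift ω.2)) ∂ψ := by
  classical
  set P' := P.map fun ω : (ℕ → E) × (ℕ → F) => (pathShift ω.1, pathShift ω.2) with hP'def
  have hP' := hP.map_pathShift hg_one
  rw [← hP'def] at hP'
  have := hP.isProb
  have := hP'.isProb
  have hM : ∀ z, Measurable fun ω : (ℕ → E) × (ℕ → F) => M 0 (ω.1 0) z := fun z =>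
    (measurable_of_finite fun a => M 0 a z).comp ((measurable_pi_apply 0).comp measurable_fst)
  have hgm : ∀ z, Measurable fun y => (g 0 z y : ℝ≥0∞) := fun z => (hg 0 z).coe_nnreal_ennreal
  -- Rebuild the law from its past: weight the past by the transition probability into `z`, draw the
  -- last observation from the density `g 0 z`, and sum over `z`. Cylinders then identify `ν` with
  -- `P`.
  let ν : Measure ((ℕ → E) × (ℕ → F)) := ∑ z, ((P'.withDensity fun ω => M 0 (ω.1 0) z).prod
    (ψ.withDensity fun y => (g 0 z y : ℝ≥0∞))).map
      fun q => (pathCons z q.1.1, pathCons q.2 q.1.2)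
  have hν : ∀ f : (ℕ → E) × (ℕ → F) → ℝ≥0∞, Measurable f → ∫⁻ ω, f ω ∂ν =
      ∑ z, ∫⁻ y, g 0 z y * ∫⁻ ω, M 0 (ω.1 0) z * f (pathCons z ω.1, pathCons y ω.2) ∂P' ∂ψ := by
    intro f hf
    rw [lintegral_finsetSum_measure]
    refine Finset.sum_congr rfl fun z _ => ?_
    have hfz := hf.comp (measurable_pathCons_prod (F := F) z)
    rw [lintegral_map hf (measurable_pathCons_prod z)]
    refine (lintegral_prod_symm' _ hfz).trans ?_
    rw [
      lintegral_withDensity_eq_lintegral_mul _ (hgm z) hfz.lintegral_prod_left']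
    refine lintegral_congr fun y => ?_
    rw [Pi.mul_apply, lintegral_withDensity_eq_lintegral_mul _ (hM z)
      (g := fun ω => (f ∘ fun q : ((ℕ → E) × (ℕ → F)) × F =>
        (pathCons z q.1.1, pathCons q.2 q.1.2)) (ω, y)) (hfz.comp measurable_prodMk_right)]
    rfl
  suffices h : P = ν by rw [h, hν f hf]
  refine ext_of_cylinders ?_ ?_
  · rw [measure_univ, ← lintegral_one, hν _ measurable_const]
    simp only [mul_one]
    have h1 : ∀ z, ∫⁻ y, g 0 z y * ∫⁻ ω, M 0 (ω.1 0) z ∂P' ∂ψ = ∫⁻ ω, M 0 (ω.1 0) z ∂P' := by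
      intro z
      rw [lintegral_mul_const _ (hgm z), hg_one, one_mul]
    simp only [h1]
    rw [← lintegral_finsetSum _ fun z _ => hM z]
    simp [sum_pmf_eq_one]
  · intro n x B hB
    have hms := measurableSet_cylinder_prod (F := F) (n + 1) x B hB
    rw [hP.fidi _ _ _ hB, ← lintegral_indicator_one hms, hν _ (measurable_one.indicator hms)]
    have hB' : ∀ k, MeasurableSet (pathShift B k) := fun k => hB (k + 1)
    have hms' := measurableSet_cylinder_prod (F := F) n (pathShift x) _ hB'
    have hin : ∀ z y, ∫⁻ ω, M 0 (ω.1 0) z *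
        {ω : (ℕ → E) × (ℕ → F) | ∀ k ≤ n + 1, ω.1 k = x k ∧ ω.2 k ∈ B k}.indicator 1
          (pathCons z ω.1, pathCons y ω.2) ∂P' =
        (if z = x 0 then M 0 (x 1) (x 0) else 0) * (B 0).indicator 1 y *
          P' {ω | ∀ k ≤ n, ω.1 k = pathShift x k ∧ ω.2 k ∈ pathShift B k} := by
      intro z y
      rw [← lintegral_indicator_one hms', ← lintegral_const_mul _ (measurable_one.indicator hms')]
      refine lintegral_congr fun ω => ?_
      by_cases hω : ω ∈ {ω : (ℕ → E) × (ℕ → F) |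
          ∀ k ≤ n, ω.1 k = pathShift x k ∧ ω.2 k ∈ pathShift B k}
      · rw [Set.indicator_of_mem hω]
        have h0 : ω.1 0 = x 1 := (hω 0 (Nat.zero_le _)).1
        by_cases hz : z = x 0
        · by_cases hy : y ∈ B 0
          · rw [Set.indicator_of_mem, Set.indicator_of_mem hy, if_pos hz, h0, hz]
            · simp
            · intro k hk
              cases k with
              | zero => exact ⟨hz, hy⟩
              | succ k => exact hω k (by omega)
          · rw [Set.indicator_of_notMem, Set.indicator_of_notMem hy]
            · simp
            · exact fun h => hy (h 0 (Nat.zero_le _)).2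
        · rw [Set.indicator_of_notMem, if_neg hz]
          · simp
          · exact fun h => hz (h 0 (Nat.zero_le _)).1
      · rw [Set.indicator_of_notMem hω, Set.indicator_of_notMem]
        · simp
        · exact fun h => hω fun k hk => h (k + 1) (by omega)
    simp only [hin]
    rw [Finset.sum_eq_single (x 0) (fun z _ hz => by simp [hz]) (by simp)]
    simp only [if_true]
    have hcomm : ∀ y, (g 0 (x 0) y : ℝ≥0∞) * (M 0 (x 1) (x 0) * (B 0).indicator 1 y *
        P' {ω | ∀ k ≤ n, ω.1 k = pathShift x k ∧ ω.2 k ∈ pathShift B k}) =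
        (B 0).indicator (fun y => (g 0 (x 0) y : ℝ≥0∞)) y * (M 0 (x 1) (x 0) *
        P' {ω | ∀ k ≤ n, ω.1 k = pathShift x k ∧ ω.2 k ∈ pathShift B k}) := by
      intro y
      by_cases hy : y ∈ B 0
      · rw [Set.indicator_of_mem hy, Set.indicator_of_mem hy]; simp
      · rw [Set.indicator_of_notMem hy, Set.indicator_of_notMem hy]; simp
    simp only [hcomm]
    rw [lintegral_mul_const _ ((hgm _).indicator (hB 0)), lintegral_indicator (hB 0),
      hP'.fidi n _ _ hB', Finset.prod_range_succ' _ (n + 1), Finset.prod_range_succ' _ n]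
    simp only [pathShift_apply, zero_add]
    ring

end OneStep

/-! ### The conditional law of the signal given the observations. -/

section Conditional

/-- A hidden Markov model disintegrates along a regular conditional law of the signal. -/
lemma IsRegCondLaw.lintegral_eq {E F : Type*} [MeasurableSpace E] [MeasurableSpace F]
    {P : Measure ((ℕ → E) × (ℕ → F))} [IsProbabilityMeasure P]
    {κ : Kernel (ℕ → F) (ℕ → E)} (hκ : IsRegCondLaw P κ) {A : Set (ℕ → E)}
    (hA : MeasurableSet A) {h : (ℕ → F) → ℝ≥0∞} (hh : Measurable h) :
    ∫⁻ ω, A.indicator 1 ω.1 * h ω.2 ∂P = ∫⁻ y, h y * κ y A ∂(P.map Prod.snd) := by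
  have := hκ.isMarkov
  have hκA : Measurable fun y => κ y A := κ.measurable_coe hA
  have hAP : MeasurableSet (Prod.fst ⁻¹' A : Set ((ℕ → E) × (ℕ → F))) := measurable_fst hA
  -- The defining property of conditional expectation, restated without real integrals: `κ y A` is a
  -- density of the law of the observations restricted to the signal event.
  have hmeq : (P.restrict (Prod.fst ⁻¹' A)).map Prod.snd =
      (P.map Prod.snd).withDensity fun y => κ y A := by
    refine Measure.ext fun B hB => ?_
    have hBP : MeasurableSet (Prod.snd ⁻¹' B : Set ((ℕ → E) × (ℕ → F))) := measurable_snd hB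
    rw [Measure.map_apply measurable_snd hB, Measure.restrict_apply hBP, withDensity_apply _ hB,
      setLIntegral_map hB hκA measurable_snd]
    have hle : MeasurableSpace.comap Prod.snd inferInstance ≤
        (inferInstance : MeasurableSpace ((ℕ → E) × (ℕ → F))) := measurable_snd.comap_le
    have h1 := setIntegral_condExp (μ := P) hle
      (f := (Prod.fst ⁻¹' A).indicator fun _ => (1 : ℝ))
      ((integrable_const (1 : ℝ)).indicator hAP)
      (s := Prod.snd ⁻¹' B) ⟨B, hB, rfl⟩
    have h2 : ∫ ω in Prod.snd ⁻¹' B, (κ ω.2).real A ∂P =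
        ∫ ω in Prod.snd ⁻¹' B, (Prod.fst ⁻¹' A).indicator (fun _ => (1 : ℝ)) ω ∂P := by
      rw [← h1]
      exact integral_congr_ae (ae_restrict_of_ae (hκ.ae_eq A hA))
    rw [integral_indicator_const _ hAP] at h2
    have h3 : ∫ ω in Prod.snd ⁻¹' B, (κ ω.2).real A ∂P =
        (∫⁻ ω in Prod.snd ⁻¹' B, κ ω.2 A ∂P).toReal :=
      integral_toReal (hκA.comp measurable_snd).aemeasurable
        (Filter.Eventually.of_forall fun ω => measure_lt_top _ _)
    rw [h3, smul_eq_mul, mul_one, measureReal_def, Measure.restrict_apply hAP,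
      Set.inter_comm] at h2
    refine ((ENNReal.toReal_eq_toReal_iff' ?_ (measure_ne_top _ _)).1 h2).symm
    refine (lt_of_le_of_lt (lintegral_mono (g := fun _ => 1) fun ω => prob_le_one) ?_).ne
    simp
  calc ∫⁻ ω, A.indicator 1 ω.1 * h ω.2 ∂P
      = ∫⁻ ω in Prod.fst ⁻¹' A, h ω.2 ∂P := by
        rw [← lintegral_indicator hAP]
        refine lintegral_congr fun ω => ?_
        by_cases hω : ω.1 ∈ A
        · rw [Set.indicator_of_mem hω, Set.indicator_of_mem (s := Prod.fst ⁻¹' A) hω]; simp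
        · rw [Set.indicator_of_notMem hω, Set.indicator_of_notMem (s := Prod.fst ⁻¹' A) hω]; simp
    _ = ∫⁻ y, h y ∂((P.restrict (Prod.fst ⁻¹' A)).map Prod.snd) :=
        (lintegral_map hh measurable_snd).symm
    _ = _ := by
        rw [hmeq, lintegral_withDensity_eq_lintegral_mul _ hκA hh]
        exact lintegral_congr fun y => mul_comm _ _

variable {E F : Type*} [Fintype E]

/-- The backward recursion of `phi` with an arbitrary terminal function `v`. -/
noncomputable def phiFrom (M : ℕ → E → PMF E) (g : ℕ → E → F → ℝ≥0) (v : E → ℝ≥0∞) (y : ℕ → F) :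
    ℕ → E → ℝ≥0∞
  | 0 => v
  | k + 1 => fun x => ∑ x', M k x x' * g k x' (y k) * phiFrom M g v y k x'

lemma phiFrom_one (M : ℕ → E → PMF E) (g : ℕ → E → F → ℝ≥0) (y : ℕ → F) (k : ℕ) :
    phiFrom M g (fun _ => 1) y k = phi M g y k := by
  induction k with
  | zero => rfl
  | succ k ih => funext x; rw [phiFrom, phi, ih]

/-- Absorbing the observation at time 0 into the terminal function gives the same recursion for the
past model. This is why the terminal function must be arbitrary in an induction that removes time 0.
-/
lemma phiFrom_pathCons (M : ℕ → E → PMF E) (g : ℕ → E → F → ℝ≥0) (v : E → ℝ≥0∞) (b : F)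
    (y : ℕ → F) (n : ℕ) :
    phiFrom M g v (pathCons b y) (n + 1) = phiFrom (fun k => M (k + 1)) (fun k => g (k + 1))
      (fun x => ∑ x', M 0 x x' * g 0 x' b * v x') y n := by
  induction n with
  | zero => rfl
  | succ n ih => funext x; rw [phiFrom, ih]; rfl

/-- `φ_{k+1}(x) M^y(x, x') = M(x, x') g(x', y) φ_k(x')`. -/
lemma phi_mul_condKernel (M : ℕ → E → PMF E) (g : ℕ → E → F → ℝ≥0) (y : ℕ → F) (k : ℕ)
    (x x' : E) :
    phi M g y (k + 1) x * condKernel M g y k x x' = M k x x' * g k x' (y k) * phi M g y k x' := by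
  rw [condKernel]
  split_ifs with h
  · rw [PMF.ofFintype_apply]
    exact ENNReal.mul_div_cancel h.ne' (phi_ne_top M g y (k + 1) x)
  -- A vanishing sum of nonnegative terms has vanishing terms, so the default kernel plays no role.
  · have h0 : phi M g y (k + 1) x = 0 := le_antisymm (not_lt.1 h) bot_le
    rw [h0, zero_mul]
    rw [phi, Finset.sum_eq_zero_iff] at h0
    exact (h0 x' (Finset.mem_univ _)).symm

lemma phi_mul_prod_condKernel (M : ℕ → E → PMF E) (g : ℕ → E → F → ℝ≥0) (y : ℕ → F) (x : ℕ → E)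
    (n : ℕ) :
    phi M g y n (x n) * ∏ k ∈ Finset.range n, condKernel M g y k (x (k + 1)) (x k) =
      ∏ k ∈ Finset.range n, (M k (x (k + 1)) (x k) * g k (x k) (y k)) := by
  induction n with
  | zero => simp [phi]
  | succ n ih =>
    rw [Finset.prod_range_succ, Finset.prod_range_succ, ← ih, mul_left_comm, phi_mul_condKernel]
    ring

variable [MeasurableSpace F]

lemma measurable_phi {M : ℕ → E → PMF E} {g : ℕ → E → F → ℝ≥0}
    (hg : ∀ k x, Measurable (g k x)) (k : ℕ) (x : E) : Measurable fun y => phi M g y k x := by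
  induction k generalizing x with
  | zero => exact measurable_const
  | succ k ih =>
    refine Finset.measurable_fun_sum _ fun x' _ => ?_
    exact ((((hg k x').comp (measurable_pi_apply k)).coe_nnreal_ennreal).const_mul _).mul (ih x')

lemma measurable_condKernel {M : ℕ → E → PMF E} {g : ℕ → E → F → ℝ≥0}
    (hg : ∀ k x, Measurable (g k x)) (k : ℕ) (x x' : E) :
    Measurable fun y => condKernel M g y k x x' := by
  classical
  have h : (fun y => condKernel M g y k x x') = fun y => if 0 < phi M g y (k + 1) x then
      M k x x' * g k x' (y k) * phi M g y k x' / phi M g y (k + 1) x else M k x x' := by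
    funext y
    rw [condKernel]
    split_ifs with h
    · rw [PMF.ofFintype_apply]
    · rfl
  rw [h]
  refine Measurable.ite (measurableSet_lt measurable_const (measurable_phi hg _ _)) ?_
    measurable_const
  exact (((((hg k x').comp (measurable_pi_apply k)).coe_nnreal_ennreal).const_mul _).mul
    (measurable_phi hg _ _)).div (measurable_phi hg _ _)

variable [MeasurableSpace E] [MeasurableSingletonClass E]

/-- A division-free Bayes formula. From state `x n`, following the prescribed path contributes the
product of the `M` and `g` factors, while summing over all paths with final weight `v` contributes
`phiFrom`; `h` balances the two for each `y`. The factor `R` stands in for a quotient by `phiFrom`,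
which may vanish. -/
lemma lintegral_cylinder_mul (n : ℕ) {M : ℕ → E → PMF E} {p : ℕ → PMF E} {ψ : Measure F}
    [SigmaFinite ψ] {g : ℕ → E → F → ℝ≥0} {P : Measure ((ℕ → E) × (ℕ → F))}
    (hg : ∀ k x, Measurable (g k x)) (hg_one : ∀ k x, ∫⁻ y, (g k x y : ℝ≥0∞) ∂ψ = 1)
    (hP : IsHMMLaw M p ψ g P) (x : ℕ → E) (v : E → ℝ≥0∞) {c R : (ℕ → F) → ℝ≥0∞}
    (hc : Measurable c) (hR : Measurable R)
    (h : ∀ y, phiFrom M g v y n (x n) * R y =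
      c y * ∏ k ∈ Finset.range n, (M k (x (k + 1)) (x k) * g k (x k) (y k))) :
    ∫⁻ ω, {X : ℕ → E | ∀ k ≤ n, X k = x k}.indicator 1 ω.1 * c ω.2 ∂P =
      ∫⁻ ω, v (ω.1 0) * {X : ℕ → E | X n = x n}.indicator 1 ω.1 * R ω.2 ∂P := by
  induction n generalizing M p g P x v c R with
  | zero =>
    refine lintegral_congr fun ω => ?_
    have hy := h ω.2
    simp only [phiFrom, Finset.range_zero, Finset.prod_empty, mul_one] at hy
    simp only [Nat.le_zero, forall_eq, ← hy]
    by_cases hω : ω.1 0 = x 0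
    · rw [Set.indicator_of_mem (s := {X : ℕ → E | X 0 = x 0}) hω, hω]; simp
    · rw [Set.indicator_of_notMem (s := {X : ℕ → E | X 0 = x 0}) hω]; simp
  | succ n ih =>
    classical
    have hcyl := measurableSet_cylinder (n + 1) x
    have hcyl' := measurableSet_cylinder n (pathShift x)
    have hind : ∀ {s : Set (ℕ → E)}, MeasurableSet s →
        Measurable fun ω : (ℕ → E) × (ℕ → F) => s.indicator (1 : (ℕ → E) → ℝ≥0∞) ω.1 :=
      fun hs => (measurable_one.indicator hs).comp measurable_fst
    have hv0 : ∀ u : E → ℝ≥0∞, Measurable fun ω : (ℕ → E) × (ℕ → F) => u (ω.1 0) := fun u =>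
      (measurable_of_finite u).comp ((measurable_pi_apply 0).comp measurable_fst)
    have hcons : ∀ b : F, Measurable (pathCons b : (ℕ → F) → ℕ → F) := measurable_pathCons_right
    have hP' := hP.map_pathShift hg_one
    rw [hP.lintegral_eq hg hg_one
      (f := fun ω => {X : ℕ → E | ∀ k ≤ n + 1, X k = x k}.indicator 1 ω.1 * c ω.2)
      ((hind hcyl).mul (hc.comp measurable_snd)),
      hP.lintegral_eq hg hg_one
      (f := fun ω => v (ω.1 0) * {X : ℕ → E | X (n + 1) = x (n + 1)}.indicator 1 ω.1 * R ω.2)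
      (((hv0 v).mul (hind (measurableSet_apply_eq _ _))).mul (hR.comp measurable_snd))]
    set P' := P.map fun ω : (ℕ → E) × (ℕ → F) => (pathShift ω.1, pathShift ω.2)
    have := hP'.isProb
    have hLm : ∀ b, Measurable fun ω : (ℕ → E) × (ℕ → F) =>
        {X : ℕ → E | ∀ k ≤ n, X k = pathShift x k}.indicator 1 ω.1 * c (pathCons b ω.2) :=
      fun b => (hind hcyl').mul ((hc.comp (hcons b)).comp measurable_snd)
    have hL : ∀ z b, ∫⁻ ω, M 0 (ω.1 0) z *
        ({X : ℕ → E | ∀ k ≤ n + 1, X k = x k}.indicator 1 (pathCons z ω.1) *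
          c (pathCons b ω.2)) ∂P' = if z = x 0 then M 0 (x 1) (x 0) *
        ∫⁻ ω, {X : ℕ → E | ∀ k ≤ n, X k = pathShift x k}.indicator 1 ω.1 *
          c (pathCons b ω.2) ∂P' else 0 := by
      intro z b
      split_ifs with hz
      · rw [← lintegral_const_mul _ (hLm b)]
        refine lintegral_congr fun ω => ?_
        by_cases hω : ω.1 ∈ {X : ℕ → E | ∀ k ≤ n, X k = pathShift x k}
        · have h0 : ω.1 0 = x 1 := hω 0 (Nat.zero_le _)
          rw [Set.indicator_of_mem hω, Set.indicator_of_mem, h0, hz]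
          · rfl
          intro k hk
          cases k with
          | zero => exact hz
          | succ k => exact hω k (by omega)
        · rw [Set.indicator_of_notMem hω, Set.indicator_of_notMem]
          · simp
          · exact fun h => hω fun k hk => h (k + 1) (by omega)
      · rw [← lintegral_zero (μ := P')]
        refine lintegral_congr fun ω => ?_
        rw [Set.indicator_of_notMem]
        · simp
        · exact fun h => hz (h 0 (Nat.zero_le _))
    simp only [hL]
    rw [Finset.sum_eq_single (x 0) (fun z _ hz => by simp [hz]) (by simp)]
    have hmeas : ∀ z, Measurable fun q : ((ℕ → E) × (ℕ → F)) × F => M 0 (q.1.1 0) z *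
        (v z * {X : ℕ → E | X (n + 1) = x (n + 1)}.indicator 1 (pathCons z q.1.1) *
          R (pathCons q.2 q.1.2)) := by
      intro z
      refine ((hv0 fun a => M 0 a z).comp measurable_fst).mul ((measurable_const.mul ?_).mul ?_)
      · exact ((measurable_one.indicator (measurableSet_apply_eq _ _)).comp (measurable_pathCons_right z)).comp
          (measurable_fst.comp measurable_fst)
      · exact hR.comp (measurable_pathCons.comp
          (measurable_snd.prodMk (measurable_snd.comp measurable_fst)))
    have hinner : ∀ z, Measurable fun b => (g 0 z b : ℝ≥0∞) * ∫⁻ ω, M 0 (ω.1 0) z *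
        (v z * {X : ℕ → E | X (n + 1) = x (n + 1)}.indicator 1 (pathCons z ω.1) *
          R (pathCons b ω.2)) ∂P' := fun z =>
      ((hg 0 z).coe_nnreal_ennreal).mul (hmeas z).lintegral_prod_left'
    simp only [pathCons_zero, if_true]
    rw [← lintegral_finsetSum _ fun z _ => hinner z]
    refine lintegral_congr fun b => ?_
    have hRb : Measurable fun y => R (pathCons b y) := hR.comp (hcons b)
    have hcb : Measurable fun y => g 0 (x 0) b * M 0 (x 1) (x 0) * c (pathCons b y) :=
      (hc.comp (hcons b)).const_mul _
    -- With the last observation `b` fixed, the induction hypothesis applies to the past model: the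
    -- last step goes into the terminal function on one side and into `c` on the other.
    have key := ih (fun k => hg (k + 1)) (fun k => hg_one (k + 1)) hP' (pathShift x)
      (fun a => ∑ z, M 0 a z * g 0 z b * v z) hcb hRb (fun y => by
        have hy := h (pathCons b y)
        rw [phiFrom_pathCons, Finset.prod_range_succ'] at hy
        simp only [pathShift_apply]
        rw [hy]
        simp only [pathCons_zero, pathCons_succ, zero_add]
        ring)
    rw [← mul_assoc, ← lintegral_const_mul _ (hLm b)]
    refine Eq.trans (lintegral_congr fun ω => ?_) (key.trans ?_)
    · ring
    · have hz : ∀ z, Measurable fun ω : (ℕ → E) × (ℕ → F) => M 0 (ω.1 0) z *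
          (v z * {X : ℕ → E | X (n + 1) = x (n + 1)}.indicator 1 (pathCons z ω.1) *
            R (pathCons b ω.2)) := fun z => (hmeas z).comp measurable_prodMk_right
      rw [Finset.sum_congr rfl fun z _ => (lintegral_const_mul _ (hz z)).symm,
        ← lintegral_finsetSum _ fun z _ => (hz z).const_mul _]
      refine lintegral_congr fun ω => ?_
      rw [Finset.sum_mul, Finset.sum_mul]
      refine Finset.sum_congr rfl fun z _ => ?_
      have : {X : ℕ → E | X (n + 1) = x (n + 1)}.indicator (1 : (ℕ → E) → ℝ≥0∞)
          (pathCons z ω.1) = {X : ℕ → E | X n = pathShift x n}.indicator 1 ω.1 := rfl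
      rw [this]
      ring

/-- Given the observations, the signal is a chain with the conditional transition kernels. -/
theorem IsRegCondLaw.ae_isChainLaw {M : ℕ → E → PMF E} {p : ℕ → PMF E} {ψ : Measure F}
    [SigmaFinite ψ] {g : ℕ → E → F → ℝ≥0} {P : Measure ((ℕ → E) × (ℕ → F))}
    (hg : ∀ k x, Measurable (g k x)) (hg_one : ∀ k x, ∫⁻ y, (g k x y : ℝ≥0∞) ∂ψ = 1)
    (hP : IsHMMLaw M p ψ g P) {κ : Kernel (ℕ → F) (ℕ → E)} (hκ : IsRegCondLaw P κ) :
    ∀ᵐ ω ∂P, ∃ q, IsChainLaw (condKernel M g ω.2) q (κ ω.2) := by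
  have := hP.isProb
  have := hκ.isMarkov
  obtain ⟨e, -⟩ := (p 0).support_nonempty
  have hmap : IsProbabilityMeasure (P.map Prod.snd) :=
    Measure.isProbabilityMeasure_map measurable_snd.aemeasurable
  have hK : ∀ n (x : ℕ → E), Measurable fun y =>
      ∏ k ∈ Finset.range n, condKernel M g y k (x (k + 1)) (x k) := fun n x =>
    Finset.measurable_fun_prod _ fun k _ => measurable_condKernel hg k _ _
  have hone : ∀ n (x : ℕ → E), ∀ᵐ y ∂(P.map Prod.snd), κ y {X | ∀ k ≤ n, X k = x k} =
      κ y {X | X n = x n} * ∏ k ∈ Finset.range n, condKernel M g y k (x (k + 1)) (x k) := by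
    intro n x
    refine ae_eq_of_forall_setLIntegral_eq_of_sigmaFinite
      (κ.measurable_coe (measurableSet_cylinder n x))
      ((κ.measurable_coe (measurableSet_apply_eq _ _)).mul (hK n x)) fun B hB _ => ?_
    have hBm : Measurable (B.indicator (1 : (ℕ → F) → ℝ≥0∞)) := measurable_one.indicator hB
    -- Here `R` is the indicator of `B` times the product of conditional kernels; the balance
    -- condition is the telescoping identity `phi_mul_prod_condKernel`.
    have h1 := lintegral_cylinder_mul n hg hg_one hP x (fun _ => 1) hBm (hBm.mul (hK n x))
      (fun y => by
        rw [phiFrom_one, Pi.mul_apply, mul_left_comm, phi_mul_prod_condKernel])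
    simp only [one_mul] at h1
    rw [hκ.lintegral_eq (measurableSet_cylinder n x) hBm,
      hκ.lintegral_eq (measurableSet_apply_eq _ _) (hBm.mul (hK n x))] at h1
    rw [← lintegral_indicator hB, ← lintegral_indicator hB]
    refine Eq.trans (lintegral_congr fun y => ?_) (h1.trans (lintegral_congr fun y => ?_))
    · by_cases hy : y ∈ B <;> simp [hy]
    · by_cases hy : y ∈ B
      · simp [hy, mul_comm]
      · simp [hy]
  -- Only countably many cylinders occur once paths are cut to finite segments, so a single null set
  -- suffices. The default `e` fills indices beyond `n`, which no identity sees.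
  let ex : (n : ℕ) → (Fin (n + 1) → E) → ℕ → E := fun n u i =>
    if h : i < n + 1 then u ⟨i, h⟩ else e
  have hall : ∀ᵐ y ∂(P.map Prod.snd), ∀ (n : ℕ) (u : Fin (n + 1) → E),
      κ y {X | ∀ k ≤ n, X k = ex n u k} = κ y {X | X n = ex n u n} *
        ∏ k ∈ Finset.range n, condKernel M g y k (ex n u (k + 1)) (ex n u k) :=
    ae_all_iff.2 fun n => ae_all_iff.2 fun u => hone n (ex n u)
  filter_upwards [ae_of_ae_map measurable_snd.aemeasurable hall] with ω hω
  refine ⟨fun n => PMF.ofFintype (fun x => κ ω.2 {X | X n = x}) (sum_measure_apply_eq n), inferInstance, ?_⟩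
  intro n x
  have hx : ∀ k ≤ n, ex n (fun i => x i) k = x k := fun k hk =>
    dif_pos (Nat.lt_succ_of_le hk)
  have h := hω n fun i => x i
  rw [PMF.ofFintype_apply]
  convert h using 2
  · ext X
    exact forall₂_congr fun k hk => by rw [hx k hk]
  · rw [hx n le_rfl]
  · refine Finset.prod_congr rfl fun k hk => ?_
    have := Finset.mem_range.1 hk
    rw [hx k (by omega), hx (k + 1) (by omega)]

end Conditional

/-! ### Comparison of measures on restricted sets. -/

section Hahn

variable {α : Type*} [MeasurableSpace α] {μ ν : Measure α}

lemma restrict_le_restrict_of_subset_iUnion {s : ℕ → Set α} (hs : ∀ n, MeasurableSet (s n))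
    (h : ∀ n, μ.restrict (s n) ≤ ν.restrict (s n)) {A : Set α} (hA : MeasurableSet A)
    (hsub : A ⊆ ⋃ n, s n) : μ.restrict A ≤ ν.restrict A := by
  refine Measure.le_iff.2 fun t ht => ?_
  rw [Measure.restrict_apply ht, Measure.restrict_apply ht]
  have hd := MeasurableSet.disjointed hs
  have hdec : t ∩ A = ⋃ n, (t ∩ A) ∩ disjointed s n := by
    rw [← Set.inter_iUnion, iUnion_disjointed]
    exact (Set.inter_eq_left.2 (Set.inter_subset_right.trans hsub)).symm
  have hdisj : Pairwise (Function.onFun Disjoint fun n => (t ∩ A) ∩ disjointed s n) :=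
    fun i j hij => (disjoint_disjointed s hij).mono Set.inter_subset_right Set.inter_subset_right
  rw [hdec, measure_iUnion hdisj fun n => (ht.inter hA).inter (hd n),
    measure_iUnion hdisj fun n => (ht.inter hA).inter (hd n)]
  refine ENNReal.tsum_le_tsum fun n => ?_
  have h1 := Measure.le_iff.1 (h n) _ ((ht.inter hA).inter (hd n))
  rwa [Measure.restrict_apply ((ht.inter hA).inter (hd n)),
    Measure.restrict_apply ((ht.inter hA).inter (hd n)),
    Set.inter_eq_left.2 (Set.inter_subset_right.trans (disjointed_subset s n))] at h1

/-- A strict inequality on a part of `A` could not be compensated on the rest, as the total masses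
agree. -/
lemma restrict_eq_of_restrict_le [IsFiniteMeasure ν] {A : Set α}
    (hle : μ.restrict A ≤ ν.restrict A) (h : μ A = ν A) : μ.restrict A = ν.restrict A := by
  refine Measure.ext fun t ht => le_antisymm (Measure.le_iff.1 hle t ht) ?_
  rw [Measure.restrict_apply ht, Measure.restrict_apply ht]
  have h1 := Measure.le_iff.1 hle _ ht.compl
  rw [Measure.restrict_apply ht.compl, Measure.restrict_apply ht.compl] at h1
  have h2 := measure_inter_add_sdiff (μ := μ) A ht
  have h3 := measure_inter_add_sdiff (μ := ν) A ht
  rw [Set.inter_comm, Set.sdiff_eq, Set.inter_comm A] at h2 h3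
  refine (ENNReal.add_le_add_iff_right (measure_ne_top ν (tᶜ ∩ A))).1 ?_
  rw [h3, ← h, ← h2]
  gcongr

end Hahn

/-! ### Tail events through shifts, and chains as models with trivial observations. -/

section Shift

variable {E : Type*}

lemma iterate_pathShift_apply (n : ℕ) (X : ℕ → E) (k : ℕ) : pathShift^[n] X k = X (k + n) := by
  induction n generalizing X with
  | zero => rfl
  | succ n ih => rw [Function.iterate_succ_apply, ih, pathShift_apply, add_assoc]

lemma measurable_iterate_pathShift [MeasurableSpace E] (n : ℕ) :
    Measurable (pathShift^[n] : (ℕ → E) → ℕ → E) :=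
  measurable_pathShift.iterate n

lemma measurable_prodMk_unit [MeasurableSpace E] : Measurable fun X : ℕ → E => (X, fun _ : ℕ => ()) :=
  measurable_id.prodMk measurable_const

/-- Tail events are the events that are determined by the path before each time. -/
lemma measurableSet_tail_iff [MeasurableSpace E] {A : Set (ℕ → E)} :
    MeasurableSet[tail E] A ↔
      ∀ n : ℕ, ∃ B : Set (ℕ → E), MeasurableSet B ∧ pathShift^[n] ⁻¹' B = A := by
  have h : ∀ n : ℕ, ⨆ k : ℕ, ⨆ _ : n ≤ k,
      MeasurableSpace.comap (fun X : ℕ → E => X k) inferInstance =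
      MeasurableSpace.comap (pathShift^[n] : (ℕ → E) → ℕ → E) inferInstance := by
    intro n
    refine le_antisymm (iSup₂_le fun k hk => ?_) ?_
    · rintro _ ⟨B, hB, rfl⟩
      refine ⟨(fun X : ℕ → E => X (k - n)) ⁻¹' B, measurable_pi_apply (k - n) hB, ?_⟩
      ext X
      simp only [Set.mem_preimage, iterate_pathShift_apply, Nat.sub_add_cancel hk]
    · simp only [MeasurableSpace.pi, MeasurableSpace.comap_iSup]
      refine iSup_le fun k => ?_
      rw [MeasurableSpace.comap_comp]
      refine le_trans (le_of_eq ?_) (le_iSup₂ (k + n) (Nat.le_add_left n k))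
      congr 1
      funext X
      exact iterate_pathShift_apply n X k
  rw [tail, MeasurableSpace.measurableSet_iInf]
  exact forall_congr' fun n => by rw [h n]; rfl

lemma measurableSet_of_tail [MeasurableSpace E] {A : Set (ℕ → E)}
    (hA : MeasurableSet[tail E] A) : MeasurableSet A := by
  obtain ⟨B, hB, rfl⟩ := measurableSet_tail_iff.1 hA 0
  exact hB

lemma sum_mul_indicator_pathCons [Fintype E] (u : E → ℝ≥0∞) (a : E) (X : ℕ → E) :
    ∑ z, u z * {X : ℕ → E | X 0 = a}.indicator 1 (pathCons z X) = u a := by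
  classical
  rw [Finset.sum_eq_single a]
  · rw [Set.indicator_of_mem (s := {X : ℕ → E | X 0 = a}) (a := pathCons a X) rfl]
    exact mul_one _
  · intro z _ hz
    rw [Set.indicator_of_notMem (s := {X : ℕ → E | X 0 = a}) (a := pathCons z X) hz, mul_zero]
  · simp

lemma IsChainLaw.measure_zero [MeasurableSpace E] {M : ℕ → E → PMF E} {p : ℕ → PMF E}
    {μ : Measure (ℕ → E)} (hμ : IsChainLaw M p μ) (x : E) : μ {X | X 0 = x} = p 0 x := by
  simpa using hμ.fidi 0 fun _ => x

/-- A chain is the signal of a hidden Markov model with trivial observations. -/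
lemma IsChainLaw.isHMMLaw [MeasurableSpace E] [MeasurableSingletonClass E] {M : ℕ → E → PMF E} {p : ℕ → PMF E}
    {μ : Measure (ℕ → E)} (hμ : IsChainLaw M p μ) :
    IsHMMLaw M p (Measure.dirac ()) (fun _ _ _ => 1) (μ.map fun X => (X, fun _ : ℕ => ())) := by
  have := hμ.isProb
  refine ⟨Measure.isProbabilityMeasure_map measurable_prodMk_unit.aemeasurable, ?_⟩
  intro n x B hB
  rw [Measure.map_apply measurable_prodMk_unit (measurableSet_cylinder_prod n x B hB)]
  simp only [ENNReal.coe_one, setLIntegral_one]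
  by_cases h : ∀ k ≤ n, () ∈ B k
  · rw [← hμ.fidi, Finset.prod_eq_one, mul_one]
    · congr 1
      ext X
      exact forall₂_congr fun k hk => and_iff_left (h k hk)
    · intro k hk
      rw [Measure.dirac_apply_of_mem (h k (Nat.lt_succ_iff.1 (Finset.mem_range.1 hk)))]
  · push Not at h
    obtain ⟨k, hk, hB'⟩ := h
    rw [Finset.prod_eq_zero (i := k) (Finset.mem_range.2 (Nat.lt_succ_of_le hk)), mul_zero]
    · convert measure_empty (μ := μ)
      exact Set.eq_empty_of_forall_notMem fun X hX => hB' (hX k hk).2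
    · rw [Measure.dirac_apply' _ (hB k), Set.indicator_of_notMem hB']

lemma map_pathShift_prodMk_unit [MeasurableSpace E] {μ : Measure (ℕ → E)} :
    (μ.map fun X => (X, fun _ : ℕ => ())).map (fun ω => (pathShift ω.1, pathShift ω.2)) =
      (μ.map pathShift).map fun X => (X, fun _ : ℕ => ()) := by
  rw [Measure.map_map measurable_pathShift_prod measurable_prodMk_unit,
    Measure.map_map measurable_prodMk_unit measurable_pathShift]
  rfl

end Shift

/-! ### Markov property, tail events and uniqueness for chains. -/

section ChainShift

variable {E : Type*} [Fintype E] [MeasurableSpace E] [MeasurableSingletonClass E]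
  {M : ℕ → E → PMF E} {p q : ℕ → PMF E} {μ ν : Measure (ℕ → E)}

/-- The past of a chain is a chain. -/
theorem IsChainLaw.map_pathShift (hμ : IsChainLaw M p μ) :
    IsChainLaw (fun k => M (k + 1)) (fun k => p (k + 1)) (μ.map pathShift) := by
  have := hμ.isProb
  have hP := hμ.isHMMLaw.map_pathShift (fun _ _ => by simp)
  rw [map_pathShift_prodMk_unit] at hP
  refine ⟨Measure.isProbabilityMeasure_map measurable_pathShift.aemeasurable, fun n x => ?_⟩
  have h := hP.fidi n x (fun _ => Set.univ) fun _ => MeasurableSet.univ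
  rw [Measure.map_apply measurable_prodMk_unit
    (measurableSet_cylinder_prod n x _ fun _ => MeasurableSet.univ)] at h
  simpa using h

/-- Integration of the last variable of a chain. -/
theorem IsChainLaw.lintegral_eq (hμ : IsChainLaw M p μ) {f : (ℕ → E) → ℝ≥0∞}
    (hf : Measurable f) :
    ∫⁻ X, f X ∂μ = ∫⁻ X, ∑ z, M 0 (X 0) z * f (pathCons z X) ∂(μ.map pathShift) := by
  have hM : ∀ z, Measurable fun X : ℕ → E => M 0 (X 0) z := fun z =>
    (measurable_of_finite fun a => M 0 a z).comp (measurable_pi_apply 0)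
  have h := hμ.isHMMLaw.lintegral_eq (fun _ _ => measurable_const) (fun _ _ => by simp)
    (hf.comp measurable_fst)
  rw [map_pathShift_prodMk_unit, lintegral_map (hf.comp measurable_fst) measurable_prodMk_unit] at h
  have hz : ∀ z, Measurable fun X : ℕ → E => M 0 (X 0) z * f (pathCons z X) := fun z =>
    (hM z).mul (hf.comp (measurable_pathCons_right z))
  rw [lintegral_finsetSum _ fun z _ => hz z]
  refine h.trans (Finset.sum_congr rfl fun z _ => ?_)
  simp only [Function.comp_apply, ENNReal.coe_one, one_mul, lintegral_const,
    Measure.dirac_apply_of_mem (Set.mem_univ ()), mul_one]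
  exact lintegral_map ((hz z).comp measurable_fst) measurable_prodMk_unit

lemma IsChainLaw.measure_inter_preimage (hμ : IsChainLaw M p μ) {t s : Set (ℕ → E)}
    (ht : MeasurableSet t) (hs : MeasurableSet s) :
    μ (t ∩ pathShift ⁻¹' s) =
      ∫⁻ X in s, ∑ z, M 0 (X 0) z * t.indicator 1 (pathCons z X) ∂(μ.map pathShift) := by
  have hts := ht.inter (measurable_pathShift hs)
  rw [← lintegral_indicator_one hts, hμ.lintegral_eq (measurable_one.indicator hts),
    ← lintegral_indicator hs]
  refine lintegral_congr fun X => ?_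
  by_cases hX : X ∈ s
  · rw [Set.indicator_of_mem hX]
    refine Finset.sum_congr rfl fun z _ => ?_
    by_cases hz : pathCons z X ∈ t
    · rw [Set.indicator_of_mem hz,
        Set.indicator_of_mem (s := t ∩ pathShift ⁻¹' s) (a := pathCons z X) ⟨hz, hX⟩]
    · rw [Set.indicator_of_notMem hz, Set.indicator_of_notMem fun h => hz h.1]
  · rw [Set.indicator_of_notMem hX]
    refine Finset.sum_eq_zero fun z _ => ?_
    rw [Set.indicator_of_notMem fun h => hX h.2, mul_zero]

lemma IsChainLaw.lintegral_apply_zero (hμ : IsChainLaw M p μ) (u : E → ℝ≥0∞) :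
    ∫⁻ X, u (X 0) ∂μ = ∑ w, p 0 w * u w := by
  have h := lintegral_map (μ := μ) (measurable_of_finite u)
    (measurable_pi_apply (X := fun _ : ℕ => E) 0)
  rw [← h, lintegral_fintype]
  refine Finset.sum_congr rfl fun w _ => ?_
  rw [Measure.map_apply (measurable_pi_apply 0) (measurableSet_singleton w), ← hμ.measure_zero w,
    mul_comm]
  rfl

/-- The marginals of a chain are absolute probabilities. -/
theorem IsChainLaw.mem_absProbs (hμ : IsChainLaw M p μ) : p ∈ absProbs M := by
  intro k
  induction k generalizing M p μ with
  | zero =>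
    ext x
    classical
    have hx := measurableSet_apply_eq (E := E) 0 x
    rw [← hμ.measure_zero, ← lintegral_indicator_one hx,
      hμ.lintegral_eq (measurable_one.indicator hx), PMF.bind_apply, tsum_fintype]
    have h : ∀ X : ℕ → E, ∑ z, M 0 (X 0) z *
        {X : ℕ → E | X 0 = x}.indicator 1 (pathCons z X) = M 0 (X 0) x := by
      exact fun X => sum_mul_indicator_pathCons (fun z => M 0 (X 0) z) x X
    simp only [h]
    rw [hμ.map_pathShift.lintegral_apply_zero fun a => M 0 a x]
  | succ k ih => exact ih hμ.map_pathShift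

lemma IsChainLaw.measure_apply (hμ : IsChainLaw M p μ) (n : ℕ) (x : E) :
    μ {X | X n = x} = p n x := by
  induction n generalizing M p μ with
  | zero => exact hμ.measure_zero x
  | succ n ih =>
    rw [← ih hμ.map_pathShift, Measure.map_apply measurable_pathShift (measurableSet_apply_eq n x)]
    rfl

/-- The Markov property at time `-n`. -/
lemma IsChainLaw.measure_iterate_inter_cylinder (hμ : IsChainLaw M p μ) (n : ℕ) (x : ℕ → E)
    {B : Set (ℕ → E)} (hB : MeasurableSet B) :
    μ (pathShift^[n] ⁻¹' B ∩ {X | ∀ k ≤ n, X k = x k}) =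
      μ (pathShift^[n] ⁻¹' B ∩ {X | X n = x n}) *
        ∏ k ∈ Finset.range n, M k (x (k + 1)) (x k) := by
  induction n generalizing M p μ x with
  | zero => simp
  | succ n ih =>
    have hBn := measurable_iterate_pathShift n hB
    have hs := hBn.inter (measurableSet_cylinder n (pathShift x))
    have hset : pathShift^[n + 1] ⁻¹' B ∩ {X | ∀ k ≤ n + 1, X k = x k} =
        {X | X 0 = x 0} ∩ pathShift ⁻¹'
          (pathShift^[n] ⁻¹' B ∩ {X | ∀ k ≤ n, X k = pathShift x k}) := by
      ext X
      simp only [Set.mem_inter_iff, Set.mem_preimage, Function.iterate_succ_apply,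
        Set.mem_ofPred_eq, pathShift_apply]
      constructor
      · rintro ⟨h1, h2⟩
        exact ⟨h2 0 (Nat.zero_le _), h1, fun k hk => h2 (k + 1) (by omega)⟩
      · rintro ⟨h0, h1, h2⟩
        refine ⟨h1, fun k hk => ?_⟩
        cases k with
        | zero => exact h0
        | succ k => exact h2 k (by omega)
    have hset' : pathShift^[n + 1] ⁻¹' B ∩ {X | X (n + 1) = x (n + 1)} =
        pathShift ⁻¹' (pathShift^[n] ⁻¹' B ∩ {X | X n = pathShift x n}) := rfl
    rw [hset, hμ.measure_inter_preimage (measurableSet_apply_eq 0 _) hs, hset',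
      ← Measure.map_apply measurable_pathShift (hBn.inter (measurableSet_apply_eq n _)),
      Finset.prod_range_succ', ← mul_assoc]
    have hc : ∀ X ∈ pathShift^[n] ⁻¹' B ∩ {X | ∀ k ≤ n, X k = pathShift x k},
        ∑ z, M 0 (X 0) z * {X : ℕ → E | X 0 = x 0}.indicator 1 (pathCons z X) =
          M 0 (x 1) (x 0) := by
      intro X hX
      have h0 : X 0 = x 1 := hX.2 0 (Nat.zero_le _)
      rw [sum_mul_indicator_pathCons (fun z => M 0 (X 0) z), h0]
    rw [setLIntegral_congr_fun hs hc, setLIntegral_const, ih hμ.map_pathShift, mul_comm]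
    rfl

/-- Conditioning a chain on a tail event yields a chain with the same transitions. -/
lemma IsChainLaw.cond_tail (hμ : IsChainLaw M p μ) {A : Set (ℕ → E)}
    (hA : MeasurableSet[tail E] A) (h0 : μ A ≠ 0) : ∃ q, IsChainLaw M q μ[|A] := by
  have := hμ.isProb
  have hA' := measurableSet_of_tail hA
  have hprob := cond_isProbabilityMeasure h0
  refine ⟨fun n => PMF.ofFintype (fun x => μ[|A] {X | X n = x}) (sum_measure_apply_eq n), hprob, fun n x => ?_⟩
  -- The event depends only on the path up to time `-n`, so the Markov property leaves the later
  -- transitions intact.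
  obtain ⟨B, hB, rfl⟩ := measurableSet_tail_iff.1 hA n
  rw [PMF.ofFintype_apply, cond_apply hA', cond_apply hA', hμ.measure_iterate_inter_cylinder n x hB,
    mul_assoc]

/-- If `A` is not null, conditioning on it gives a chain law with the same transitions, hence by
uniqueness the original law; so `A` has probability one. -/
lemma IsChainLaw.tail_zero_one (hμ : IsChainLaw M p μ) (huniq : (absProbs M).Subsingleton)
    {A : Set (ℕ → E)} (hA : MeasurableSet[tail E] A) : μ A = μ A ^ 2 := by
  have := hμ.isProb
  by_cases h0 : μ A = 0
  · simp [h0]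
  · obtain ⟨q, hq⟩ := hμ.cond_tail hA h0
    have hqp := huniq hq.mem_absProbs hμ.mem_absProbs
    subst hqp
    have h1 : μ[A|A] = 1 := cond_apply_self h0 (measure_ne_top _ _)
    rw [hq.unique hμ] at h1
    rw [h1, one_pow]

/-- With equal transitions, both laws integrate the same nonnegative one-step function against their
pasts, so domination of the pasts propagates forward. Hahn sets can thus be chosen arbitrarily far
back. -/
lemma IsChainLaw.isHahnDecomposition_preimage (hμ : IsChainLaw M p μ) (hν : IsChainLaw M q ν)
    (n : ℕ) {s : Set (ℕ → E)}
    (hs : IsHahnDecomposition (μ.map pathShift^[n]) (ν.map pathShift^[n]) s) :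
    IsHahnDecomposition μ ν (pathShift^[n] ⁻¹' s) := by
  have one : ∀ {M : ℕ → E → PMF E} {p q : ℕ → PMF E} {μ ν : Measure (ℕ → E)},
      IsChainLaw M p μ → IsChainLaw M q ν → ∀ s : Set (ℕ → E), MeasurableSet s →
      (μ.map pathShift).restrict s ≤ (ν.map pathShift).restrict s →
      μ.restrict (pathShift ⁻¹' s) ≤ ν.restrict (pathShift ⁻¹' s) := by
    intro M p q μ ν hμ hν s hs hle
    refine Measure.le_iff.2 fun t ht => ?_
    rw [Measure.restrict_apply ht, Measure.restrict_apply ht, hμ.measure_inter_preimage ht hs,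
      hν.measure_inter_preimage ht hs]
    exact lintegral_mono' hle le_rfl
  induction n generalizing M p q μ ν with
  | zero => simpa using hs
  | succ n ih =>
    rw [Function.iterate_succ, ← Measure.map_map (measurable_iterate_pathShift n)
      measurable_pathShift, ← Measure.map_map (measurable_iterate_pathShift n)
      measurable_pathShift] at hs
    have h := ih hμ.map_pathShift hν.map_pathShift hs
    rw [Function.iterate_succ, Set.preimage_comp]
    refine ⟨measurable_pathShift h.measurableSet, one hμ hν _ h.measurableSet h.le_on, ?_⟩
    rw [← Set.preimage_compl]
    exact one hν hμ _ h.measurableSet.compl h.ge_on_compl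

/-- Chains with the same transitions which agree on the tail are equal. -/
theorem IsChainLaw.eq_of_tail (hμ : IsChainLaw M p μ) (hν : IsChainLaw M q ν)
    (h : ∀ A, MeasurableSet[tail E] A → μ A = ν A) : p = q := by
  have := hμ.isProb
  have := hν.isProb
  choose s hs using fun n : ℕ => exists_isHahnDecomposition (μ.map pathShift^[n])
    (ν.map pathShift^[n])
  have hH := fun n => hμ.isHahnDecomposition_preimage hν n (hs n)
  -- The limsup of Hahn sets from ever more remote pasts is a tail event. It is covered by these
  -- sets and its complement by their complements, so each measure dominates on one piece; equal
  -- tail masses turn both dominations into equalities.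
  let A : Set (ℕ → E) := ⋂ n : ℕ, ⋃ m : ℕ, pathShift^[m + n] ⁻¹' s (m + n)
  have hAt : MeasurableSet[tail E] A := by
    refine measurableSet_tail_iff.2 fun N => ?_
    -- Dropping the first `N` sets does not change a limsup.
    refine ⟨⋂ n : ℕ, ⋃ m : ℕ, pathShift^[m + n] ⁻¹' s (m + n + N), ?_, ?_⟩
    · exact MeasurableSet.iInter fun n => MeasurableSet.iUnion fun m =>
        measurable_iterate_pathShift _ (hs _).measurableSet
    · ext X
      simp only [A, Set.mem_preimage, Set.mem_iInter, Set.mem_iUnion,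
        ← Function.iterate_add_apply]
      constructor
      · intro hX n
        obtain ⟨m, hm⟩ := hX n
        exact ⟨m + N, by rwa [add_right_comm]⟩
      · intro hX n
        obtain ⟨m, hm⟩ := hX (n + N)
        exact ⟨m, by rwa [add_assoc]⟩
  have hA := measurableSet_of_tail hAt
  have h1 : μ.restrict A = ν.restrict A := by
    refine restrict_eq_of_restrict_le (restrict_le_restrict_of_subset_iUnion
      (fun n => (hH n).measurableSet) (fun n => (hH n).le_on) hA ?_) (h A hAt)
    intro X hX
    obtain ⟨m, hm⟩ := Set.mem_iUnion.1 (Set.mem_iInter.1 hX 0)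
    exact Set.mem_iUnion.2 ⟨m, hm⟩
  have h2 : ν.restrict Aᶜ = μ.restrict Aᶜ := by
    refine restrict_eq_of_restrict_le (restrict_le_restrict_of_subset_iUnion
      (fun n => (hH n).measurableSet.compl) (fun n => (hH n).ge_on_compl) hA.compl ?_) ?_
    · intro X hX
      simp only [A, Set.mem_compl_iff, Set.mem_iInter, Set.mem_iUnion, not_forall, not_exists] at hX
      obtain ⟨n, hn⟩ := hX
      exact Set.mem_iUnion.2 ⟨n, by simpa using hn 0⟩
    · rw [prob_compl_eq_one_sub hA, prob_compl_eq_one_sub hA, h A hAt]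
  have hμν : μ = ν := by
    rw [← Measure.restrict_add_restrict_compl (μ := μ) hA, h1, ← h2,
      Measure.restrict_add_restrict_compl hA]
  funext n
  ext x
  rw [← hμ.measure_apply, hμν, hν.measure_apply]

end ChainShift

/-! ### Weak ergodicity and uniqueness of absolute probabilities. -/

section WeakErgodicity

open Filter Topology

variable {E : Type*}

/-- The transition kernel from time `-(k + j)` to time `-k`. -/
noncomputable def iterKernel (M : ℕ → E → PMF E) (k : ℕ) : ℕ → E → PMF E
  | 0 => PMF.pure
  | j + 1 => fun x => (M (k + j) x).bind (iterKernel M k j)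

/-- The distribution at any time asymptotically does not depend on the initial state. -/
def WeaklyErgodic (M : ℕ → E → PMF E) : Prop :=
  ∀ k, ∀ ε : ℝ≥0∞, 0 < ε → ∃ j, ∀ x z z', iterKernel M k j z x ≤ iterKernel M k j z' x + ε

/-- The definition splits off the earliest step; absolute probabilities require splitting off the
latest. -/
lemma iterKernel_succ_eq_bind (M : ℕ → E → PMF E) (k j : ℕ) (x : E) :
    iterKernel M k (j + 1) x = (iterKernel M (k + 1) j x).bind (M k) := by
  induction j generalizing x with
  | zero => simp only [iterKernel, PMF.pure_bind, add_zero]; exact PMF.bind_pure _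
  | succ j ih =>
    rw [iterKernel, show iterKernel M k (j + 1) = _ from funext ih, iterKernel, PMF.bind_bind,
      Nat.add_right_comm]
    rfl

lemma bind_iterKernel {M : ℕ → E → PMF E} {p : ℕ → PMF E} (hp : p ∈ absProbs M) (k j : ℕ) :
    (p (k + j)).bind (iterKernel M k j) = p k := by
  induction j with
  | zero => exact PMF.bind_pure _
  | succ j ih =>
    rw [← ih, ← hp (k + j), PMF.bind_bind]
    rfl

variable [Fintype E]

lemma sum_pmf_mul_le (q r : PMF E) (f : E → ℝ≥0∞) (ε : ℝ≥0∞) (h : ∀ z z', f z ≤ f z' + ε) :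
    ∑ z, q z * f z ≤ ∑ z, r z * f z + ε := by
  have h1 : ∀ z', ∑ z, q z * f z ≤ f z' + ε := fun z' => by
    calc ∑ z, q z * f z ≤ ∑ z, q z * (f z' + ε) := by gcongr with z; exact h z z'
      _ = f z' + ε := by rw [← Finset.sum_mul, sum_pmf_eq_one, one_mul]
  calc ∑ z, q z * f z = ∑ z', r z' * ∑ z, q z * f z := by
        rw [← Finset.sum_mul, sum_pmf_eq_one, one_mul]
    _ ≤ ∑ z', r z' * (f z' + ε) := by gcongr with z'; exact h1 z'
    _ = ∑ z, r z * f z + ε := by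
        simp only [mul_add, Finset.sum_add_distrib]
        rw [← Finset.sum_mul _ _ ε, sum_pmf_eq_one, one_mul]

lemma WeaklyErgodic.subsingleton_absProbs {M : ℕ → E → PMF E} (hM : WeaklyErgodic M) :
    (absProbs M).Subsingleton := by
  have hle : ∀ {p q : ℕ → PMF E}, p ∈ absProbs M → q ∈ absProbs M → ∀ k x, p k x ≤ q k x := by
    intro p q hp hq k x
    refine ENNReal.le_of_forall_pos_le_add fun ε hε _ => ?_
    obtain ⟨j, hj⟩ := hM k ε (by exact_mod_cast hε)
    rw [← bind_iterKernel hp k j, ← bind_iterKernel hq k j, PMF.bind_apply, PMF.bind_apply,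
      tsum_fintype, tsum_fintype]
    exact sum_pmf_mul_le _ _ _ _ (hj x)
  intro p hp q hq
  funext k
  ext x
  exact le_antisymm (hle hp hq k x) (hle hq hp k x)

/-- Chains started further and further in the past accumulate at a sequence of absolute
probabilities. -/
lemma exists_absProbs_tendsto (M : ℕ → E → PMF E) (z : ℕ → E) :
    ∃ q ∈ absProbs M, ∀ k x, Tendsto (fun n => iterKernel M k (n - k) (z n) x)
      (hyperfilter ℕ : Filter ℕ) (𝓝 (q k x)) := by
  -- Compactness of `ℝ≥0∞` gives limits along one ultrafilter for all `k` and `x` at once, replacing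
  -- a diagonal subsequence. Finiteness of `E` lets sums pass to the limit, so no mass is lost.
  have hlim : ∀ k x, ∃ a : ℝ≥0∞, Tendsto (fun n => iterKernel M k (n - k) (z n) x)
      (hyperfilter ℕ : Filter ℕ) (𝓝 a) := fun k x =>
    ⟨_, ((hyperfilter ℕ).map fun n => iterKernel M k (n - k) (z n) x).le_nhds_lim⟩
  choose a ha using hlim
  have hsum : ∀ k, ∑ x, a k x = 1 := by
    intro k
    refine tendsto_nhds_unique (tendsto_finsetSum _ fun x _ => ha k x) ?_
    simp only [sum_pmf_eq_one]
    exact tendsto_const_nhds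
  refine ⟨fun k => PMF.ofFintype (a k) (hsum k), fun k => ?_, ha⟩
  ext x
  rw [PMF.bind_apply, tsum_fintype]
  simp only [PMF.ofFintype_apply]
  refine tendsto_nhds_unique (tendsto_finsetSum _ fun w _ =>
    ENNReal.Tendsto.mul_const (ha (k + 1) w) (Or.inr (PMF.apply_ne_top (M k w) x))) ?_
  refine (ha k x).congr' ?_
  have hev : ∀ᶠ n in (hyperfilter ℕ : Filter ℕ), k + 1 ≤ n :=
    (Nat.hyperfilter_le_atTop) (eventually_ge_atTop (k + 1))
  filter_upwards [hev] with n hn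
  rw [← tsum_fintype (L := SummationFilter.unconditional E), ← PMF.bind_apply,
    ← iterKernel_succ_eq_bind]
  congr 3
  omega

/-- If ergodicity fails, two families of starting states keep a gap `ε` at a fixed time; their
limits would be two different sequences of absolute probabilities. -/
lemma weaklyErgodic_of_subsingleton {M : ℕ → E → PMF E} (h : (absProbs M).Subsingleton) :
    WeaklyErgodic M := by
  by_contra hM
  unfold WeaklyErgodic at hM
  push Not at hM
  obtain ⟨k, ε, hε, hM⟩ := hM
  choose x z z' hlt using hM
  -- The bad states are indexed by the number of steps `n - k`, the limits by the starting index
  -- `n`.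
  obtain ⟨q, hq, hql⟩ := exists_absProbs_tendsto M fun n => z (n - k)
  obtain ⟨q', hq', hql'⟩ := exists_absProbs_tendsto M fun n => z' (n - k)
  obtain rfl := h hq hq'
  have hev : ∀ᶠ n in (hyperfilter ℕ : Filter ℕ), ∀ x, iterKernel M k (n - k) (z (n - k)) x <
      iterKernel M k (n - k) (z' (n - k)) x + ε := by
    refine eventually_all.2 fun x => (hql k x).eventually_lt ((hql' k x).add_const ε) ?_
    exact ENNReal.lt_add_right (PMF.apply_ne_top _ _) hε.ne'
  obtain ⟨n, hn⟩ := hev.exists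
  exact (hn (x (n - k))).not_gt (hlt (n - k))

end WeakErgodicity

/-! ### Meeting probabilities of two chains. -/

section Coupling

open Filter Topology

variable {E : Type*} [Fintype E] {M : ℕ → E → PMF E}

open Classical in
/-- The probability that two chains which start at time `-(k + j)` and move independently until
they meet do not meet up to time `-k`. -/
noncomputable def noMeet (M : ℕ → E → PMF E) (k : ℕ) : ℕ → E → E → ℝ≥0∞
  | 0 => fun z z' => if z = z' then 0 else 1
  | j + 1 => fun z z' => if z = z' then 0 else
      ∑ w, ∑ w', M (k + j) z w * M (k + j) z' w' * noMeet M k j w w'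

lemma noMeet_self (k j : ℕ) (z : E) : noMeet M k j z z = 0 := by
  cases j <;> simp [noMeet]

lemma sum_sum_pmf_mul_left (q r : PMF E) (f : E → ℝ≥0∞) :
    ∑ w, ∑ w', q w * r w' * f w = ∑ w, q w * f w := by
  refine Finset.sum_congr rfl fun w _ => ?_
  rw [← Finset.sum_mul, ← Finset.mul_sum, sum_pmf_eq_one, mul_one]

lemma sum_sum_pmf_mul_right (q r : PMF E) (f : E → ℝ≥0∞) :
    ∑ w, ∑ w', q w * r w' * f w' = ∑ w', r w' * f w' := by
  rw [Finset.sum_comm]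
  simp only [mul_comm (q _)]
  exact sum_sum_pmf_mul_left r q f

lemma iterKernel_succ_apply (k j : ℕ) (z x : E) :
    iterKernel M k (j + 1) z x = ∑ w, M (k + j) z w * iterKernel M k j w x := by
  rw [iterKernel, PMF.bind_apply, tsum_fintype]

/-- The coupling inequality: after meeting, the two chains can be taken to coincide. -/
lemma iterKernel_le_add_noMeet (k j : ℕ) (x z z' : E) :
    iterKernel M k j z x ≤ iterKernel M k j z' x + noMeet M k j z z' := by
  induction j generalizing z z' with
  | zero =>
    by_cases h : z = z'
    · rw [h]; exact le_self_add
    · simp only [noMeet, if_neg h]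
      exact (PMF.coe_le_one _ _).trans le_add_self
  | succ j ih =>
    by_cases h : z = z'
    · rw [h]; exact le_self_add
    · simp only [noMeet, if_neg h, iterKernel_succ_apply]
      rw [← sum_sum_pmf_mul_left (M (k + j) z) (M (k + j) z'),
        ← sum_sum_pmf_mul_right (M (k + j) z) (M (k + j) z'), ← Finset.sum_add_distrib]
      refine Finset.sum_le_sum fun w _ => ?_
      rw [← Finset.sum_add_distrib]
      refine Finset.sum_le_sum fun w' _ => ?_
      rw [← mul_add]
      gcongr
      exact ih w w'

/-- The sum is the probability that two fully independent chains end in the same state, and such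
chains have met. -/
lemma noMeet_add_sum_le_one (k j : ℕ) (z z' : E) :
    noMeet M k j z z' + ∑ x, iterKernel M k j z x * iterKernel M k j z' x ≤ 1 := by
  have hS : ∀ j z z', ∑ x, iterKernel M k j z x * iterKernel M k j z' x ≤ 1 := by
    intro j z z'
    rw [← sum_pmf_eq_one (iterKernel M k j z)]
    exact Finset.sum_le_sum fun x _ => mul_le_of_le_one_right' (PMF.coe_le_one _ _)
  induction j generalizing z z' with
  | zero =>
    by_cases h : z = z'
    · rw [h, noMeet_self, zero_add]
      exact hS 0 z' z'
    · rw [Finset.sum_eq_zero, add_zero]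
      · simp [noMeet, h]
      · intro x _
        by_cases hx : x = z
        · have : x ≠ z' := fun h' => h (hx.symm.trans h')
          simp [iterKernel, this]
        · simp [iterKernel, hx]
  | succ j ih =>
    by_cases h : z = z'
    · rw [h, noMeet_self, zero_add]
      exact hS (j + 1) z' z'
    · have hexp : ∑ x, iterKernel M k (j + 1) z x * iterKernel M k (j + 1) z' x =
          ∑ w, ∑ w', M (k + j) z w * M (k + j) z' w' *
            ∑ x, iterKernel M k j w x * iterKernel M k j w' x := by
        simp_rw [iterKernel_succ_apply, Finset.sum_mul_sum, Finset.mul_sum]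
        rw [Finset.sum_comm]
        refine Finset.sum_congr rfl fun w _ => ?_
        rw [Finset.sum_comm]
        refine Finset.sum_congr rfl fun w' _ => Finset.sum_congr rfl fun x _ => ?_
        ring
      rw [hexp]
      simp only [noMeet, if_neg h]
      rw [← Finset.sum_add_distrib]
      calc _ ≤ ∑ w, ∑ w', M (k + j) z w * M (k + j) z' w' * 1 := by
            refine Finset.sum_le_sum fun w _ => ?_
            rw [← Finset.sum_add_distrib]
            refine Finset.sum_le_sum fun w' _ => ?_
            rw [← mul_add]
            gcongr
            exact ih w w'
        _ = 1 := by
            rw [sum_sum_pmf_mul_left _ _ fun _ => 1]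
            simp [sum_pmf_eq_one]

/-- The chains must fail to meet in the older `i` steps and then, from whatever states they reach,
in the remaining `j`. -/
lemma noMeet_add_le {k j : ℕ} {C : ℝ≥0∞} (hC : ∀ z z', noMeet M k j z z' ≤ C) (i : ℕ) (z z' : E) :
    noMeet M k (j + i) z z' ≤ C * noMeet M (k + j) i z z' := by
  induction i generalizing z z' with
  | zero =>
    by_cases h : z = z'
    · rw [h, noMeet_self]; exact zero_le
    · simpa [noMeet, h] using hC z z'
  | succ i ih =>
    by_cases h : z = z'
    · rw [h, noMeet_self]; exact zero_le
    · rw [← add_assoc]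
      simp only [noMeet, if_neg h, Finset.mul_sum, ← add_assoc]
      refine Finset.sum_le_sum fun w _ => Finset.sum_le_sum fun w' _ => ?_
      rw [mul_left_comm]
      gcongr
      exact ih w w'

/-- The bound for one block is uniform in `k`, so chaining `m` blocks gives the power. -/
lemma WeaklyErgodic.exists_noMeet_le (hM : WeaklyErgodic M) :
    ∃ ρ < (1 : ℝ≥0∞), ∀ m k : ℕ, ∃ j, ∀ z z', noMeet M k j z z' ≤ ρ ^ m := by
  rcases isEmpty_or_nonempty E with hE | hE
  · exact ⟨0, zero_lt_one, fun _ _ => ⟨0, fun z => hE.elim z⟩⟩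
  let a : ℝ≥0∞ := (Fintype.card E : ℝ≥0∞)⁻¹
  have ha : a ≠ 0 := ENNReal.inv_ne_zero.2 (ENNReal.natCast_ne_top _)
  have ha' : a ≠ ∞ := ENNReal.inv_ne_top.2 (by simp)
  have hc : a * (a / 2) ≠ 0 := mul_ne_zero ha (ENNReal.half_pos ha).ne'
  have hone : ∀ k, ∃ j, ∀ z z', noMeet M k j z z' ≤ 1 - a * (a / 2) := by
    intro k
    obtain ⟨j, hj⟩ := hM k (a / 2) (ENNReal.half_pos ha)
    refine ⟨j, fun z z' => ?_⟩
    -- By pigeonhole some state has mass at least `1 / card E` from `z'`; ergodicity with error `a /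
    -- 2` leaves mass at least `a / 2` from `z`.
    have hw : ∃ w ∈ Finset.univ, a ≤ iterKernel M k j z' w := by
      refine ENNReal.exists_le_of_sum_le Finset.univ_nonempty ?_
      rw [sum_pmf_eq_one, Finset.sum_const, Finset.card_univ, nsmul_eq_mul]
      exact ENNReal.mul_inv_le_one _
    obtain ⟨w, -, hw⟩ := hw
    have hw' : a / 2 ≤ iterKernel M k j z w := by
      have h1 := hw.trans (hj w z' z)
      rw [← ENNReal.add_halves a] at h1
      exact (ENNReal.add_le_add_iff_right (ENNReal.div_ne_top ha' two_ne_zero)).1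
        (by simpa using h1)
    have hS : a * (a / 2) ≤ ∑ x, iterKernel M k j z x * iterKernel M k j z' x := by
      refine le_trans ?_ (Finset.single_le_sum
        (f := fun x => iterKernel M k j z x * iterKernel M k j z' x) (fun _ _ => zero_le)
        (Finset.mem_univ w))
      rw [mul_comm]
      exact mul_le_mul' hw' hw
    have hfin : a * (a / 2) ≠ ∞ :=
      ENNReal.mul_ne_top ha' (ENNReal.div_ne_top ha' two_ne_zero)
    exact ENNReal.le_sub_of_add_le_right hfin
      (le_trans (by gcongr) (noMeet_add_sum_le_one k j z z'))
  refine ⟨1 - a * (a / 2), ENNReal.sub_lt_self ENNReal.one_ne_top one_ne_zero hc, fun m => ?_⟩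
  induction m with
  | zero => exact fun k => ⟨0, fun z z' => by
      simp only [pow_zero, noMeet]
      split_ifs
      · exact zero_le
      · exact le_rfl⟩
  | succ m ih =>
    intro k
    obtain ⟨j, hj⟩ := hone k
    obtain ⟨i, hi⟩ := ih (k + j)
    refine ⟨j + i, fun z z' => (noMeet_add_le hj i z z').trans ?_⟩
    rw [pow_succ']
    gcongr
    exact hi z z'

end Coupling

/-! ### Coalescence of the random maps. -/

section CouplingLaw

open Filter Topology

variable {E : Type*}

lemma compMap_eq_of_le {ξ : ℕ × E → E} {k j i : ℕ} (hji : j ≤ i)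
    (h : ∀ z z', compMap ξ k j z = compMap ξ k j z') (z z' : E) :
    compMap ξ k i z = compMap ξ k i z' := by
  induction i, hji using Nat.le_induction generalizing z z' with
  | base => exact h z z'
  | succ i _ ih => exact ih _ _

lemma setOf_not_forall_compMap_eq (k j : ℕ) :
    {ξ : ℕ × E → E | ¬ ∀ z z', compMap ξ k j z = compMap ξ k j z'} =
      ⋃ z, ⋃ z', {ξ | compMap ξ k j z ≠ compMap ξ k j z'} := by
  ext ξ
  simp

lemma coalescenceTime_lt_top_iff [Nonempty E] {ξ : ℕ × E → E} {k : ℕ} :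
    coalescenceTime ξ k < ⊤ ↔ ∃ j, ∀ z z', compMap ξ k j z = compMap ξ k j z' := by
  rw [coalescenceTime, sInf_lt_iff]
  constructor
  · rintro ⟨_, ⟨j, -, ⟨a, ha⟩, rfl⟩, -⟩
    have h : ∀ z, compMap ξ k j z = a := fun z => by
      have := Set.mem_range_self (f := compMap ξ k j) z
      rwa [ha] at this
    exact ⟨j, fun z z' => (h z).trans (h z').symm⟩
  · rintro ⟨j, hj⟩
    obtain ⟨e⟩ := ‹Nonempty E›
    -- One extra step meets the requirement of a strictly earlier time when `j = 0`.
    refine ⟨_, ⟨j + 1, Nat.succ_pos j, ⟨compMap ξ k (j + 1) e, ?_⟩, rfl⟩, ENat.natCast_lt_top _⟩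
    refine Set.eq_singleton_iff_unique_mem.2 ⟨Set.mem_range_self e, ?_⟩
    rintro _ ⟨z, rfl⟩
    exact compMap_eq_of_le (Nat.le_succ j) hj z e

lemma couplingLaw_pair [MeasurableSpace E] [MeasurableSingletonClass E]
    {M : ℕ → E → PMF E} {n : ℕ} {z z' : E} (h : z ≠ z') (w w' : E) :
    couplingLaw M {ξ | ξ (n, z) = w ∧ ξ (n, z') = w'} = M n z w * M n z' w' := by
  classical
  have hne : ((n, z) : ℕ × E) ≠ (n, z') := fun h' => h (Prod.ext_iff.1 h').2
  have hset : {ξ : ℕ × E → E | ξ (n, z) = w ∧ ξ (n, z') = w'} =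
      Set.pi (({(n, z), (n, z')} : Finset (ℕ × E)) : Set (ℕ × E))
        fun q => if q = (n, z) then {w} else {w'} := by
    ext ξ
    simp [hne.symm]
  rw [hset, couplingLaw, Measure.infinitePi_pi _ (fun q _ => by split_ifs <;> simp),
    Finset.prod_pair hne, if_pos rfl, if_neg hne.symm,
    PMF.toMeasure_apply_singleton _ _ (measurableSet_singleton _),
    PMF.toMeasure_apply_singleton _ _ (measurableSet_singleton _)]

variable [Fintype E] [MeasurableSpace E] [MeasurableSingletonClass E] {M : ℕ → E → PMF E}

/-- The σ-algebra is left free so that the lemma also applies to the one generated by the variables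
with time index below `k + j`, as independence requires. -/
lemma measurable_compMap {Ω : Type*} [MeasurableSpace Ω] (ξ : Ω → ℕ × E → E) (k j : ℕ)
    (h : ∀ i < k + j, ∀ e, Measurable fun ω => ξ ω (i, e)) (x : E) :
    Measurable fun ω => compMap (ξ ω) k j x := by
  induction j generalizing x with
  | zero => exact measurable_const
  | succ j ih =>
    have h1 : Measurable fun q : Ω × E => compMap (ξ q.1) k j q.2 :=
      measurable_from_prod_countable_left fun e => ih (fun i hi => h i (by omega)) e
    exact h1.comp (measurable_id.prodMk (h (k + j) (by omega) x))

instance isProbabilityMeasure_couplingLaw : IsProbabilityMeasure (couplingLaw M) := by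
  unfold couplingLaw
  infer_instance

lemma measurableSet_compMap_ne (k j : ℕ) (z z' : E) :
    MeasurableSet {ξ : ℕ × E → E | compMap ξ k j z ≠ compMap ξ k j z'} := by
  have h := fun x => measurable_compMap (fun ξ : ℕ × E → E => ξ) k j
    (fun i _ e => measurable_pi_apply (i, e)) x
  exact (((h z).prodMk (h z')) (Set.toFinite {q : E × E | q.1 = q.2}).measurableSet).compl

lemma couplingLaw_inter_compMap_ne {k j : ℕ} {z z' : E} (h : z ≠ z') (w w' : E) :
    couplingLaw M ({ξ | ξ (k + j, z) = w ∧ ξ (k + j, z') = w'} ∩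
      {ξ | compMap ξ k j w ≠ compMap ξ k j w'}) =
        M (k + j) z w * M (k + j) z' w' *
          couplingLaw M {ξ | compMap ξ k j w ≠ compMap ξ k j w'} := by
  let m : ℕ × E → MeasurableSpace (ℕ × E → E) := fun q =>
    MeasurableSpace.comap (fun ξ => ξ q) inferInstance
  have hm : ∀ q, m q ≤ MeasurableSpace.pi := fun q => (measurable_pi_apply q).comap_le
  have hind : iIndep m (couplingLaw M) :=
    iIndepFun_infinitePi (P := fun q : ℕ × E => (M q.1 q.2).toMeasure)
      (X := fun _ x => x) fun _ => measurable_id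
  have hdisj : Disjoint {q : ℕ × E | q.1 = k + j} {q : ℕ × E | q.1 < k + j} :=
    Set.disjoint_left.2 fun q (h1 : q.1 = k + j) (h2 : q.1 < k + j) => by omega
  have hI := indep_iSup_of_disjoint hm hind hdisj
  rw [← couplingLaw_pair h]
  refine (Indep_iff _ _ _).1 hI _ _ ?_ ?_
  · have h1 : ∀ (e a : E), MeasurableSet[⨆ q ∈ {q : ℕ × E | q.1 = k + j}, m q]
        {ξ : ℕ × E → E | ξ (k + j, e) = a} := fun e a =>
      (le_iSup₂ (f := fun q (_ : q ∈ {q : ℕ × E | q.1 = k + j}) => m q) (k + j, e) rfl) _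
        ⟨{a}, measurableSet_singleton a, rfl⟩
    exact @MeasurableSet.inter _ (⨆ q ∈ {q : ℕ × E | q.1 = k + j}, m q) _ _ (h1 z w) (h1 z' w')
  · have h2 := fun x => @measurable_compMap E _ _ _ _ (⨆ q ∈ {q : ℕ × E | q.1 < k + j}, m q)
      (fun ξ : ℕ × E → E => ξ) k j (fun i hi e => by
        refine measurable_iff_comap_le.2 ?_
        exact le_iSup₂ (f := fun q (_ : q ∈ {q : ℕ × E | q.1 < k + j}) => m q) (i, e) hi) x
    exact @MeasurableSet.compl _ _ (⨆ q ∈ {q : ℕ × E | q.1 < k + j}, m q)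
      (((h2 w).prodMk (h2 w')) (Set.toFinite {q : E × E | q.1 = q.2}).measurableSet)

/-- From distinct states the oldest step uses two independent variables, independent also of all
later layers; this is the recursion of `noMeet`. -/
lemma couplingLaw_compMap_ne (k j : ℕ) (z z' : E) :
    couplingLaw M {ξ | compMap ξ k j z ≠ compMap ξ k j z'} = noMeet M k j z z' := by
  induction j generalizing z z' with
  | zero =>
    by_cases h : z = z'
    · simp [h, noMeet_self]
    · simp [compMap, noMeet, h]
  | succ j ih =>
    by_cases h : z = z'
    · simp [h, noMeet_self]
    · have hset : {ξ : ℕ × E → E | compMap ξ k (j + 1) z ≠ compMap ξ k (j + 1) z'} =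
          ⋃ w : E × E, {ξ | ξ (k + j, z) = w.1 ∧ ξ (k + j, z') = w.2} ∩
            {ξ | compMap ξ k j w.1 ≠ compMap ξ k j w.2} := by
        ext ξ
        simp only [Set.mem_iUnion, Set.mem_inter_iff, Set.mem_ofPred_eq]
        constructor
        · exact fun hξ => ⟨(ξ (k + j, z), ξ (k + j, z')), ⟨rfl, rfl⟩, hξ⟩
        · rintro ⟨⟨w, w'⟩, ⟨h1, h2⟩, h3⟩
          simp only at h1 h2 h3
          rw [← h1, ← h2] at h3
          exact h3
      rw [hset, measure_iUnion, tsum_fintype, Fintype.sum_prod_type]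
      · simp only [couplingLaw_inter_compMap_ne h, ih, noMeet, if_neg h]
      · intro w v hwv
        refine Set.disjoint_left.2 fun ξ h1 h2 => hwv ?_
        exact Prod.ext (h1.1.1.symm.trans h2.1.1) (h1.1.2.symm.trans h2.1.2)
      · intro w
        refine MeasurableSet.inter (MeasurableSet.inter ?_ ?_) (measurableSet_compMap_ne k j _ _)
        · exact measurable_pi_apply (X := fun _ : ℕ × E => E) _ (measurableSet_singleton w.1)
        · exact measurable_pi_apply (X := fun _ : ℕ × E => E) _ (measurableSet_singleton w.2)

/-- Coalescence from the past is equivalent to weak ergodicity. -/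
theorem couplingLaw_coalescence_iff [Nonempty E] :
    couplingLaw M {ξ | ∀ k, coalescenceTime ξ k < ⊤} = 1 ↔ WeaklyErgodic M := by
  have hms : ∀ k j, MeasurableSet
      {ξ : ℕ × E → E | ¬ ∀ z z', compMap ξ k j z = compMap ξ k j z'} := fun k j => by
    rw [setOf_not_forall_compMap_eq]
    exact MeasurableSet.iUnion fun z => MeasurableSet.iUnion fun z' =>
      measurableSet_compMap_ne k j z z'
  have hcoal : {ξ : ℕ × E → E | ∀ k, coalescenceTime ξ k < ⊤}ᶜ =
      ⋃ k, ⋂ j, {ξ | ¬ ∀ z z', compMap ξ k j z = compMap ξ k j z'} := by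
    ext ξ
    simp only [coalescenceTime_lt_top_iff, Set.mem_compl_iff, Set.mem_ofPred_eq, Set.mem_iUnion,
      Set.mem_iInter, not_forall, not_exists]
  have hcoalm : MeasurableSet {ξ : ℕ × E → E | ∀ k, coalescenceTime ξ k < ⊤} := by
    rw [← MeasurableSet.compl_iff, hcoal]
    exact MeasurableSet.iUnion fun k => MeasurableSet.iInter fun j => hms k j
  rw [← prob_compl_eq_zero_iff hcoalm, hcoal, measure_iUnion_null_iff]
  constructor
  · intro h k ε hε
    have ht := tendsto_measure_iInter_atTop (μ := couplingLaw M)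
      (fun j => (hms k j).nullMeasurableSet)
      (fun i j hij ξ hξ hc => hξ fun z z' => compMap_eq_of_le hij hc z z')
      ⟨0, measure_ne_top _ _⟩
    rw [h k] at ht
    obtain ⟨j, hj⟩ := (ht.eventually_lt_const hε).exists
    -- The non-coalescence events decrease to a null set and contain each event that a given pair
    -- has not met.
    refine ⟨j, fun x z z' => (iterKernel_le_add_noMeet k j x z z').trans ?_⟩
    rw [← couplingLaw_compMap_ne]
    gcongr
    refine le_trans (measure_mono ?_) hj.le
    exact fun ξ hξ hc => hξ (hc z z')
  · intro hM k
    obtain ⟨ρ, hρ, hj⟩ := hM.exists_noMeet_le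
    -- A union bound over the pairs of starting states.
    have hle : ∀ m : ℕ, couplingLaw M
        (⋂ j, {ξ | ¬ ∀ z z', compMap ξ k j z = compMap ξ k j z'}) ≤
          (Fintype.card E * Fintype.card E : ℝ≥0∞) * ρ ^ m := by
      intro m
      obtain ⟨j, hj⟩ := hj m k
      refine (measure_mono (Set.iInter_subset _ j)).trans ?_
      rw [setOf_not_forall_compMap_eq]
      refine (measure_iUnion_fintype_le _ _).trans ?_
      calc _ ≤ ∑ z : E, ∑ z' : E, ρ ^ m := by
            refine Finset.sum_le_sum fun z _ => (measure_iUnion_fintype_le _ _).trans ?_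
            refine Finset.sum_le_sum fun z' _ => ?_
            rw [couplingLaw_compMap_ne]
            exact hj z z'
        _ = _ := by simp [mul_assoc]
    have ht : Tendsto (fun m : ℕ => (Fintype.card E * Fintype.card E : ℝ≥0∞) * ρ ^ m) atTop
        (𝓝 ((Fintype.card E * Fintype.card E : ℝ≥0∞) * 0)) :=
      ENNReal.Tendsto.const_mul (ENNReal.tendsto_pow_atTop_nhds_zero_of_lt_one hρ)
        (Or.inr (ENNReal.mul_ne_top (ENNReal.natCast_ne_top _) (ENNReal.natCast_ne_top _)))
    rw [mul_zero] at ht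
    exact le_antisymm (ge_of_tendsto' ht hle) zero_le

end CouplingLaw

end HMM

/-! ### The equivalence. -/

theorem mainTheorem3 {E F : Type*}
    [Fintype E] [MeasurableSpace E] [MeasurableSingletonClass E]
    [TopologicalSpace F] [PolishSpace F] [MeasurableSpace F] [BorelSpace F]
    (M : ℕ → E → PMF E) (p : ℕ → PMF E) (hp : p ∈ HMM.absProbs M)
    (ψ : Measure F) [SigmaFinite ψ] (g : ℕ → E → F → ℝ≥0)
    (hg : ∀ k x, Measurable (g k x)) (hg_one : ∀ k x, ∫⁻ y, (g k x y : ℝ≥0∞) ∂ψ = 1)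
    (P : Measure ((ℕ → E) × (ℕ → F))) (hP : HMM.IsHMMLaw M p ψ g P)
    (κ : Kernel (ℕ → F) (ℕ → E)) (hκ : HMM.IsRegCondLaw P κ) :
    (∀ᵐ ω ∂P, HMM.couplingLaw (HMM.condKernel M g ω.2)
        {ξ | ∀ k, HMM.coalescenceTime ξ k < ⊤} = 1) ↔
      ∃ H : Set ((ℕ → E) × (ℕ → F)), MeasurableSet H ∧ P H = 1 ∧
        ∀ ω ∈ H, ∀ A : Set (ℕ → E), MeasurableSet[HMM.tail E] A →
          ∀ (q : ℕ → PMF E) (hq : q ∈ HMM.absProbs (HMM.condKernel M g ω.2)),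
            κ ω.2 A = (κ ω.2 A) ^ 2 ∧
              (κ ω.2 A) ^ 2 = HMM.chainLaw (HMM.condKernel M g ω.2) q hq A := by
  obtain ⟨e, -⟩ := (p 0).support_nonempty
  have : Nonempty E := ⟨e⟩
  have := hP.isProb
  simp only [HMM.couplingLaw_coalescence_iff]
  constructor
  · intro h
    have hae := h.and (hκ.ae_isChainLaw hg hg_one hP)
    obtain ⟨N, hsub, hN, hN0⟩ := exists_measurable_superset_of_null (ae_iff.1 hae)
    refine ⟨Nᶜ, hN.compl, (prob_compl_eq_one_iff hN).2 hN0, fun ω hω A hA q hq => ?_⟩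
    have hgood := not_not.1 fun hbad => hω (hsub hbad)
    obtain ⟨hM, q', hq'⟩ := hgood
    have huniq := hM.subsingleton_absProbs
    have h01 := hq'.tail_zero_one huniq hA
    refine ⟨h01, h01.symm.trans ?_⟩
    -- By uniqueness the marginals of the conditional law are the given `q`, so the two chain laws
    -- coincide on all events.
    obtain rfl := huniq hq'.mem_absProbs hq
    rw [hq'.unique (HMM.isChainLaw_chainLaw _ _ hq)]
  · rintro ⟨H, hH, hPH, h⟩
    filter_upwards [(mem_ae_iff_prob_eq_one hH).2 hPH] with ω hω
    refine HMM.weaklyErgodic_of_subsingleton fun q hq q' hq' => ?_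
    -- Both chain laws agree on the tail because each equals the square of the same conditional
    -- probability.
    refine (HMM.isChainLaw_chainLaw _ q hq).eq_of_tail (HMM.isChainLaw_chainLaw _ q' hq')
      fun A hA => ?_
    rw [← (h ω hω A hA q hq).2, ← (h ω hω A hA q' hq').2]
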